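/- Proposition. For every integer $k\ge 1$ there is a constant $C_k$, depending only on $k$, such that the following holds. Let $D>0$ be real and let $G$ be a compact Hausdorff topological group that is $D$-quasirandom, i.e. every continuous unitary representation of $G$ of dimension less than $D$ is trivial. All integrals below are with respect to Haar probability measure on $G$ and on its powers. For $g\in G$, $i\in\{0,\dots,k\}$ and $\vec a\in G^k$ put \[ T_{[1,i]}^{g}(a_1,\dots,a_k)=(ga_1,\dots,ga_i,a_{i+1},\dots,a_k). \] Let $f_0,\dots,f_k:G^k\to[-1,1]$ be measurable (it suffices that each $f_i$ coincides almost everywhere with a Borel function). Then \[ \int_{G}\Big|\int_{G^{k}}\prod_{i=0}^{k} f_i\big(T_{[1,i]}^{g}\vec a\big)\,d\vec a\Big|\,dg \;\le\;\min_{0\le i\le k}\big\|N_i^{[0,k]}f_i\big\|_{\square^{k}}+C_k\,D^{-2^{-k}}. \] Here $N_i^{[0,k]}f(x_0,\dots,x_k):=f(ga_1,\dots,ga_i,a_{i+1},\dots,a_k)$, where $g,a_1,\dots,a_k$ are determined by $x_0,\dots,x_k\in G$ through the change of variables $x_0=ga_1$, $x_j=a_j^{-1}a_{j+1}$ for $1\le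 j\le k-1$, $x_k=a_k^{-1}$; explicitly, \[ N_i^{[0,k]}f(x_0,\dots,x_k)=f\big(x_0,\;x_0x_1,\;\dots,\;x_0\cdots x_{i-1},\;(x_{i+1}\cdots x_k)^{-1},\;\dots,\;x_k^{-1}\big). \] This does not depend on $x_i$ and is regarded as a function of the $k$ variables $x_j$, $j\ne i$. For a function $F$ of $k$ variables in $G$, the Gowers box norm is \[ \|F\|_{\square^k}:=\Big(\int_{G^{2k}}\ \prod_{\epsilon\in\{0,1\}^{k}}F\big(x_{1,\epsilon_1},\dots,x_{k,\epsilon_k}\big)\ \prod_{j=1}^{k}dx_{j,0}\,dx_{j,1}\Big)^{2^{-k}}. \] -/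

import Mathlib

open MeasureTheory

namespace BoxCorners

/-- A topological group is `D`-quasirandom if it has no non-trivial (continuous) unitary
representation of dimension less than `D`. -/
def IsQuasirandom (G : Type*) [Group G] [TopologicalSpace G] (D : ℝ) : Prop :=
  ∀ n : ℕ, (n : ℝ) < D →
    ∀ ρ : G →* Matrix.unitaryGroup (Fin n) ℂ, Continuous ρ → ∀ g : G, ρ g = 1

/-- The Haar probability measure of a compact group `X`, as a measure on the Borel sets of `X`.
It is used for `G` and for the compact groups `G ^ k` and `G ^ (2 k)`. On a power of `G` the Borel
sets of the product topology are used, because without second countability they can be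
more than the product of the Borel `σ`-algebras; for second countable `G` this is the usual
product measure. -/
noncomputable def haarProb (X : Type*) [Group X] [TopologicalSpace X] [IsTopologicalGroup X]
    [CompactSpace X] : @Measure X (borel X) :=
  letI : MeasurableSpace X := borel X
  haveI : BorelSpace X := ⟨rfl⟩
  Measure.haarMeasure ⊤

/-- The total mass of `haarProb X` is one. -/
theorem haarProb_univ (X : Type*) [Group X] [TopologicalSpace X] [IsTopologicalGroup X]
    [CompactSpace X] : haarProb X Set.univ = 1 := by
  let : MeasurableSpace X := borel X
  have : BorelSpace X := ⟨rfl⟩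
  exact Measure.haarMeasure_self (K₀ := (⊤ : TopologicalSpace.PositiveCompacts X))

section Algebra

variable {G : Type*} [Group G] {k : ℕ}

/-- The point `T_{[1,i]}^g (a_1, …, a_k) = (g a_1, …, g a_i, a_{i+1}, …, a_k)`.
The coordinate `a_{j+1}` is `a j`, for `j = 0, …, k - 1`. -/
def shift (i : Fin (k + 1)) (g : G) (a : Fin k → G) : Fin k → G :=
  fun j => if j.val < i.val then g * a j else a j

/-- The side length `g = x_0 x_1 ⋯ x_k` in the change of variables
`x_0 = g a_1, x_1 = a_1⁻¹ a_2, …, x_{k-1} = a_{k-1}⁻¹ a_k, x_k = a_k⁻¹`. -/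
def side (x : Fin (k + 1) → G) : G := (List.ofFn x).prod

/-- The base point `a` in the same change of variables: `a_j = (x_j ⋯ x_k)⁻¹`, `1 ≤ j ≤ k`. -/
def base (x : Fin (k + 1) → G) : Fin k → G :=
  fun j => (((List.ofFn x).drop (j.val + 1)).prod)⁻¹

/-- The variables `x_0, …, x_k` in terms of `g, a_1, …, a_k`, with the conventions
`a_0 = g⁻¹` and `a_{k+1} = 1`. -/
def vars (g : G) (a : Fin k → G) : Fin (k + 1) → G :=
  fun j => (Fin.cons (α := fun _ => G) g⁻¹ a j)⁻¹ * Fin.snoc (α := fun _ => G) a 1 j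

/-- `(N_i f)(x) = f (g a_1, …, g a_i, a_{i+1}, …, a_k)`. -/
def N (i : Fin (k + 1)) (f : (Fin k → G) → ℝ) (x : Fin (k + 1) → G) : ℝ :=
  f (shift i (side x) (base x))

/-- A function of `x_0, …, x_k` regarded as a function of the `k` variables other than `x_i`;
the value `1` given to `x_i` plays no role for functions that do not depend on `x_i`. -/
def omitVar (i : Fin (k + 1)) (F : (Fin (k + 1) → G) → ℝ) (y : Fin k → G) : ℝ :=
  F (Fin.insertNth (α := fun _ => G) i 1 y)

theorem side_mul_base (x : Fin (k + 1) → G) (j : Fin k) :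
    side x * base x j = ((List.ofFn x).take (j.val + 1)).prod := by
  unfold side base
  rw [mul_inv_eq_iff_eq_mul, List.prod_take_mul_prod_drop]

/-- `(g, a) = (side x, base x)` satisfies the defining relations of the change of variables. -/
theorem vars_side_base (x : Fin (k + 1) → G) : vars (side x) (base x) = x := by
  have h0 : ∀ j : Fin (k + 1), Fin.cons (α := fun _ => G) (side x)⁻¹ (base x) j
      = (((List.ofFn x).drop j.val).prod)⁻¹ := by
    intro j
    refine Fin.cases ?_ (fun j => ?_) j
    · simp [side]
    · simp [base]
  have h1 : ∀ j : Fin (k + 1), Fin.snoc (α := fun _ => G) (base x) 1 j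
      = (((List.ofFn x).drop (j.val + 1)).prod)⁻¹ := by
    intro j
    refine Fin.lastCases ?_ (fun j => ?_) j
    · rw [Fin.snoc_last, List.drop_of_length_le (by simp)]
      simp
    · simp [base]
  funext j
  simp only [vars, h0, h1, inv_inv]
  rw [mul_inv_eq_iff_eq_mul, List.drop_eq_getElem_cons (by rw [List.length_ofFn]; exact j.isLt),
    List.prod_cons, List.getElem_ofFn]

/-- `N_i f` does not depend on the variable `x_i`. -/
theorem N_eq_omitVar (i : Fin (k + 1)) (f : (Fin k → G) → ℝ) (x : Fin (k + 1) → G) :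
    N i f x = omitVar i (N i f) (i.removeNth x) := by
  have hx : ∀ j : Fin (k + 1), j ≠ i →
      Fin.insertNth (α := fun _ => G) i 1 (i.removeNth x) j = x j := by
    intro j hj
    obtain ⟨l, rfl⟩ := Fin.exists_succAbove_eq hj
    simp [Fin.removeNth]
  unfold omitVar N
  congr 1
  funext j
  simp only [shift, side_mul_base]
  split_ifs with h
  · congr 1
    apply List.ext_getElem
    · simp
    · intro n h1 h2
      simp only [List.length_take, List.length_ofFn] at h1
      simp only [List.getElem_take, List.getElem_ofFn]
      exact (hx _ (by rw [ne_eq, Fin.ext_iff]; simp only; omega)).symm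
  · unfold base
    congr 2
    apply List.ext_getElem
    · simp
    · intro n h1 h2
      simp only [List.getElem_drop, List.getElem_ofFn]
      exact (hx _ (by rw [ne_eq, Fin.ext_iff]; simp only; omega)).symm

end Algebra

variable {G : Type*} [Group G] [TopologicalSpace G] [IsTopologicalGroup G] [CompactSpace G]
  {k : ℕ}

/-- The Gowers box norm of a function of `k` variables in `G`: the `2 ^ k`-th root of the integral,
over all `x_{j,ε}` with `j < k` and `ε ∈ {0, 1}`, of the product of the values of `F` at the
`2 ^ k` points `(x_{j, ε_j})_j`. -/
noncomputable def boxNorm (F : (Fin k → G) → ℝ) : ℝ :=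
  (∫ x, (∏ ε : Fin k → Bool, F (fun j => x (j, ε j))) ∂(haarProb (Fin k × Bool → G))) ^
    ((1 : ℝ) / 2 ^ k)

/-- The multicorrelation sequence `c_g = ∫_{G^k} ∏_{i=0}^k f_i ∘ T_{[1,i]}^g`. -/
noncomputable def multicorrelation (f : Fin (k + 1) → (Fin k → G) → ℝ) (g : G) : ℝ :=
  ∫ a, (∏ i : Fin (k + 1), f i (shift i g a)) ∂(haarProb (Fin k → G))

end BoxCorners

/-! The constant 1 works for every $k = n + 1$. Take the $f_i$ continuous first and replace the
absolute value by a weight $h(g)$ with $|h| \le 1$. The change of variables preserves Haar measure,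
so the quantity to bound is the mean of $h(x_0 \cdots x_k) \prod_j N_j f_j(x)$, where `N j` ignores
$x_j$.

Choose adjacent variables $s = x_p$, $t = x_{p+1}$ with $i \in \{p, p+1\}$. Each of the $n$ factors
with $j \ne p, p+1$ ignores one of the $n$ remaining variables, so $n$ applications of
Cauchy–Schwarz remove them all and double those variables (`pow_avg_mul_prod_le`). With the doubled
variables $z$ fixed, $N_{p+1}$ contributes a function $A(s)$ and $N_p$ a function $B(t)$. Since $s,
t$ are adjacent, every weight is $h(P s t Q)$ with $P, Q$ depending on $z$ only, so the weights
multiply to a function $u(st)$.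

Quasirandomness bounds the mean of $A(s)B(t)u(st)$ by $|\mathbb{E}A|\,|\mathbb{E}B| + D^{-1/2}$
(`IsQuasirandom.abs_avg_mul_le`). Keep the mean that comes from $f_i$ and bound the other by 1. One
more Cauchy–Schwarz, in $z$, gives the square root of the box integral, and a $2^n$-th root gives
the claim.

The mixing bound is spectral. For $u$ of mean zero and $L^2$ norm at most 1, let $T$ be the operator
with kernel $\overline{u(xy)}$. Then $T^*T$ is compact and commutes with left translations. Its
eigenspaces for non-zero eigenvalues are finite-dimensional representations without non-zero fixed
vectors, hence of dimension at least $D$. The Hilbert–Schmidt bound then makes each eigenvalue at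
most $1/D$.

Measurable $f_i$ are approximated in $L^1$ by continuous functions; the multicorrelations and the
box integral are Lipschitz in $L^1$ because every map composed with $f_i$ preserves Haar measure. -/

namespace BoxCorners

/-! ### Haar means of continuous functions on compact groups -/

section Average

variable {X Y Z : Type*} [Group X] [TopologicalSpace X] [IsTopologicalGroup X] [CompactSpace X]
  [Group Y] [TopologicalSpace Y] [IsTopologicalGroup Y] [CompactSpace Y] [TopologicalSpace Z]

/-- The mean of a function on a compact group. -/
noncomputable def avg (F : X → ℝ) : ℝ := ∫ x, F x ∂(haarProb X)

theorem avg_eq_integral [MeasurableSpace X] [BorelSpace X] (F : X → ℝ) :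
    avg F = ∫ x, F x ∂(Measure.haarMeasure (⊤ : TopologicalSpace.PositiveCompacts X)) := by
  obtain rfl := BorelSpace.measurable_eq (α := X)
  rfl

theorem isProbabilityMeasure_haarMeasure_top [MeasurableSpace X] [BorelSpace X] :
    IsProbabilityMeasure (Measure.haarMeasure (⊤ : TopologicalSpace.PositiveCompacts X)) :=
  ⟨Measure.haarMeasure_self⟩

theorem isProbabilityMeasure_haarProb :
    @IsProbabilityMeasure X (borel X) (haarProb X) :=
  @IsProbabilityMeasure.mk X (borel X) _ (haarProb_univ X)

theorem integrable_haarProb {F : X → ℝ} (hF : Continuous F) :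
    Integrable F (haarProb X) := by
  let : MeasurableSpace X := borel X
  have : BorelSpace X := ⟨rfl⟩
  have := isProbabilityMeasure_haarMeasure_top (X := X)
  change Integrable F (Measure.haarMeasure (⊤ : TopologicalSpace.PositiveCompacts X))
  exact hF.integrable_of_hasCompactSupport (HasCompactSupport.of_compactSpace F)

theorem avg_const (c : ℝ) : avg (fun _ : X => c) = c := by
  let : MeasurableSpace X := borel X
  have : BorelSpace X := ⟨rfl⟩
  have := isProbabilityMeasure_haarMeasure_top (X := X)
  simp [avg_eq_integral]

theorem avg_add {F H : X → ℝ} (hF : Continuous F) (hH : Continuous H) :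
    avg (fun x => F x + H x) = avg F + avg H := by
  let : MeasurableSpace X := borel X
  exact integral_add (integrable_haarProb hF) (integrable_haarProb hH)

theorem avg_sub {F H : X → ℝ} (hF : Continuous F) (hH : Continuous H) :
    avg (fun x => F x - H x) = avg F - avg H := by
  let : MeasurableSpace X := borel X
  exact integral_sub (integrable_haarProb hF) (integrable_haarProb hH)

theorem avg_const_mul (c : ℝ) (F : X → ℝ) : avg (fun x => c * F x) = c * avg F := by
  let : MeasurableSpace X := borel X
  exact integral_const_mul c F

theorem avg_mul_const (c : ℝ) (F : X → ℝ) : avg (fun x => F x * c) = avg F * c := by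
  let : MeasurableSpace X := borel X
  exact integral_mul_const c F

theorem avg_mono {F H : X → ℝ} (hF : Continuous F) (hH : Continuous H) (h : ∀ x, F x ≤ H x) :
    avg F ≤ avg H := by
  let : MeasurableSpace X := borel X
  exact integral_mono (integrable_haarProb hF) (integrable_haarProb hH) h

theorem avg_nonneg {F : X → ℝ} (h : ∀ x, 0 ≤ F x) : 0 ≤ avg F := by
  let : MeasurableSpace X := borel X
  exact integral_nonneg h

theorem abs_avg_le (F : X → ℝ) : |avg F| ≤ avg fun x => |F x| := by
  let : MeasurableSpace X := borel X
  exact abs_integral_le_integral_abs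

theorem avg_le_of_le {F : X → ℝ} (hF : Continuous F) {c : ℝ} (h : ∀ x, F x ≤ c) : avg F ≤ c :=
  (avg_mono hF continuous_const h).trans (avg_const c).le

theorem abs_avg_le_of_abs_le {F : X → ℝ} (hF : Continuous F) {c : ℝ} (h : ∀ x, |F x| ≤ c) :
    |avg F| ≤ c :=
  (abs_avg_le F).trans (avg_le_of_le hF.abs h)

theorem sq_avg_le {F : X → ℝ} (hF : Continuous F) : avg F ^ 2 ≤ avg fun x => F x ^ 2 := by
  have h : 0 ≤ avg fun x => (F x ^ 2 - 2 * avg F * F x) + avg F ^ 2 :=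
    avg_nonneg fun x => by nlinarith [sq_nonneg (F x - avg F)]
  rw [avg_add (by fun_prop) (by fun_prop), avg_sub (by fun_prop) (by fun_prop), avg_const_mul,
    avg_const] at h
  nlinarith

theorem continuous_avg {F : Z → X → ℝ} (hF : Continuous fun q : Z × X => F q.1 q.2) :
    Continuous fun z => avg (F z) := by
  let : MeasurableSpace X := borel X
  have : BorelSpace X := ⟨rfl⟩
  have := isProbabilityMeasure_haarMeasure_top (X := X)
  simp only [avg_eq_integral]
  rw [← continuousOn_univ]
  exact continuousOn_integral_of_compact_support isCompact_univ hF.continuousOn (by simp)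

theorem avg_comm {F : X → Y → ℝ} (hF : Continuous fun q : X × Y => F q.1 q.2) :
    (avg fun x => avg fun y => F x y) = avg fun y => avg fun x => F x y := by
  let : MeasurableSpace X := borel X
  have : BorelSpace X := ⟨rfl⟩
  let : MeasurableSpace Y := borel Y
  have : BorelSpace Y := ⟨rfl⟩
  have := isProbabilityMeasure_haarMeasure_top (X := X)
  have := isProbabilityMeasure_haarMeasure_top (X := Y)
  simp only [avg_eq_integral]
  exact integral_integral_swap_of_hasCompactSupport hF (HasCompactSupport.of_compactSpace _)

theorem measurePreserving_monoidHom {φ : X →* Y} (hφ : Continuous φ)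
    (hs : Function.Surjective φ) :
    @MeasurePreserving X Y (borel X) (borel Y) φ (haarProb X) (haarProb Y) := by
  let : MeasurableSpace X := borel X
  have : BorelSpace X := ⟨rfl⟩
  let : MeasurableSpace Y := borel Y
  have : BorelSpace Y := ⟨rfl⟩
  have := isProbabilityMeasure_haarMeasure_top (X := X)
  have := isProbabilityMeasure_haarMeasure_top (X := Y)
  exact MonoidHom.measurePreserving (μ := Measure.haarMeasure ⊤) (ν := Measure.haarMeasure ⊤) hφ hs
    ((haarProb_univ X).trans (haarProb_univ Y).symm)

theorem avg_comp_monoidHom {φ : X →* Y} (hφ : Continuous φ)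
    (hs : Function.Surjective φ) {F : Y → ℝ} (hF : Continuous F) :
    avg (fun x => F (φ x)) = avg F := by
  let : MeasurableSpace X := borel X
  let : MeasurableSpace Y := borel Y
  have : BorelSpace Y := ⟨rfl⟩
  have h := measurePreserving_monoidHom hφ hs
  unfold avg
  rw [← h.map_eq, integral_map h.measurable.aemeasurable
    (h.map_eq ▸ (integrable_haarProb hF).aestronglyMeasurable)]

theorem avg_mul_left (F : X → ℝ) (g : X) : avg (fun x => F (g * x)) = avg F := by
  let : MeasurableSpace X := borel X
  have : BorelSpace X := ⟨rfl⟩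
  simp only [avg_eq_integral]
  exact integral_mul_left_eq_self F g

/-- Conjugation is a continuous surjective endomorphism, so it preserves Haar measure; composed with
a left translation it gives a right translation. -/
theorem avg_mul_right {F : X → ℝ} (hF : Continuous F) (g : X) :
    avg (fun x => F (x * g)) = avg F := by
  rw [← avg_mul_left _ g⁻¹]
  have h : Continuous (MulAut.conj g⁻¹).toMonoidHom := by
    change Continuous fun x => g⁻¹ * x * g⁻¹⁻¹
    fun_prop
  rw [← avg_comp_monoidHom h (MulAut.conj g⁻¹).surjective hF]
  simp [mul_assoc]

theorem avg_inv {F : X → ℝ} (hF : Continuous F) : avg (fun x => F x⁻¹) = avg F :=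
  calc avg (fun x => F x⁻¹) = avg fun y : X => avg fun x => F (x⁻¹ * y) := by
        rw [← avg_const (X := X) (avg fun x => F x⁻¹)]
        congr 1
        funext y
        rw [← avg_mul_left _ y⁻¹]
        simp
    _ = avg fun x : X => avg fun y => F (x⁻¹ * y) := avg_comm (by fun_prop)
    _ = avg F := by simp only [avg_mul_left, avg_const]

/-- The Borel sets of a product may exceed the product $\sigma$-algebra, so Fubini for product
measures is not used. Instead `F` is averaged over right translates by $(x, y)$; exchanging the
order of the means, each permitted by continuity, leaves the iterated mean. -/
theorem avg_prod {F : X × Y → ℝ} (hF : Continuous F) :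
    avg F = avg fun x => avg fun y => F (x, y) := by
  have h1 : Continuous fun z : X × Y => avg fun y => F (z.1 , z.2 * y) :=
    continuous_avg (by fun_prop)
  calc avg F = avg fun x : X => avg fun y : Y => avg fun z : X × Y => F (z * (x, y)) := by
        simp only [avg_mul_right hF, avg_const]
    _ = avg fun x : X => avg fun z : X × Y => avg fun y : Y => F (z.1 * x, z.2 * y) := by
        congr 1
        funext x
        exact avg_comm (by fun_prop)
    _ = avg fun z : X × Y => avg fun x : X => avg fun y : Y => F (z.1 * x, z.2 * y) :=
        avg_comm (continuous_avg (by fun_prop))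
    _ = avg fun x => avg fun y => F (x, y) := by
        have h2 (z : X × Y) : (avg fun x => avg fun y => F (z.1 * x, z.2 * y)) =
            avg fun x => avg fun y => F (x, y) := by
          have h3 (x : X) : (avg fun y => F (z.1 * x, z.2 * y)) = avg fun y => F (z.1 * x, y) :=
            avg_mul_left (fun y => F (z.1 * x, y)) z.2
          simp only [h3]
          exact avg_mul_left (fun x => avg fun y => F (x, y)) z.1
        simp only [h2, avg_const]

end Average

/-! ### Splitting off one coordinate, or both copies of a doubled one -/

section Coordinates

variable {G : Type*} {n : ℕ}

/-- Splitting off the coordinate `p`, as a homomorphism. -/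
def splitHom (G : Type*) [Group G] (p : Fin (n + 1)) :
    (Fin (n + 1) → G) →* G × (Fin n → G) where
  toFun x := (x p, p.removeNth x)
  map_one' := rfl
  map_mul' _ _ := rfl

@[simp]
theorem splitHom_apply [Group G] (p : Fin (n + 1)) (x : Fin (n + 1) → G) :
    splitHom G p x = (x p, p.removeNth x) := rfl

/-- Splitting off the two copies of the coordinate `p`, as a homomorphism. -/
def splitPairHom (G : Type*) [Group G] (p : Fin (n + 1)) :
    (Fin (n + 1) × Bool → G) →* (Fin n × Bool → G) × (G × G) where
  toFun x := (fun q => x (p.succAbove q.1, q.2), (x (p, false), x (p, true)))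
  map_one' := rfl
  map_mul' _ _ := rfl

/-- Inserting two copies of the coordinate `p`. -/
def insertPair (p : Fin (n + 1)) (q : (Fin n × Bool → G) × (G × G)) :
    Fin (n + 1) × Bool → G := fun r =>
  p.insertNth (α := fun _ => G) (bif r.2 then q.2.2 else q.2.1) (fun j => q.1 (j, r.2)) r.1

theorem prod_insertPair (p : Fin (n + 1)) (W : (Fin (n + 1) → G) → ℝ)
    (q : (Fin n × Bool → G) × (G × G)) :
    ∏ ε : Fin (n + 1) → Bool, W (fun j => insertPair p q (j, ε j)) =
      ∏ ε : Fin n → Bool, (W (p.insertNth q.2.1 fun j => q.1 (j, ε j)) *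
        W (p.insertNth q.2.2 fun j => q.1 (j, ε j))) := by
  rw [← (Fin.insertNthEquiv (fun _ => Bool) p).prod_comp, Fintype.prod_prod_type,
    Fintype.prod_bool, ← Finset.prod_mul_distrib]
  refine Finset.prod_congr rfl fun ε _ => ?_
  rw [mul_comm]
  congr 2 <;>
  · funext j
    refine Fin.succAboveCases p ?_ (fun j => ?_) j <;> simp [insertPair]

theorem continuous_insertPair [TopologicalSpace G] (p : Fin (n + 1)) :
    Continuous (insertPair p : (Fin n × Bool → G) × (G × G) → _) := by
  refine continuous_pi fun r => ?_
  obtain ⟨j, b⟩ := r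
  unfold insertPair
  refine Fin.succAboveCases p ?_ (fun j => ?_) j
  · cases b <;> simp <;> fun_prop
  · simp; fun_prop

variable [Group G] [TopologicalSpace G] [IsTopologicalGroup G] [CompactSpace G]

theorem avg_insertNth (p : Fin (n + 1)) {F : (Fin (n + 1) → G) → ℝ} (hF : Continuous F) :
    avg F = avg fun y : Fin n → G => avg fun s : G => F (p.insertNth s y) := by
  have hi : Continuous fun q : G × (Fin n → G) =>
      (p.insertNth q.1 q.2 : Fin (n + 1) → G) := by fun_prop
  have h := avg_comp_monoidHom (φ := splitHom G p)
    (by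
      change Continuous fun x : Fin (n + 1) → G => (x p, fun j => x (p.succAbove j))
      fun_prop)
    (fun q => ⟨p.insertNth q.1 q.2, by simp⟩) (hF.comp hi)
  simp only [Function.comp_apply, splitHom_apply, Fin.insertNth_self_removeNth] at h
  rw [h, avg_prod (hF.comp hi)]
  exact avg_comm (hF.comp hi)

theorem avg_insertPair (p : Fin (n + 1)) {F : (Fin (n + 1) × Bool → G) → ℝ} (hF : Continuous F) :
    avg F = avg fun q => F (insertPair p q) := by
  have h := avg_comp_monoidHom (φ := splitPairHom G p)
    (by
      change Continuous fun x : Fin (n + 1) × Bool → G =>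
        ((fun q : Fin n × Bool => x (p.succAbove q.1, q.2)), (x (p, false), x (p, true)))
      fun_prop)
    (fun q => ⟨insertPair p q, by simp [splitPairHom, insertPair]⟩)
    (hF.comp (continuous_insertPair p))
  rw [Function.comp_def] at h
  rw [← h]
  congr 1
  funext x
  congr 1
  funext r
  obtain ⟨j, b⟩ := r
  refine Fin.succAboveCases p ?_ (fun j => ?_) j
  · cases b <;> simp [insertPair, splitPairHom]
  · simp [insertPair, splitPairHom]

end Coordinates

/-! ### Compact operators on Hilbert space -/

section Hilbert

variable {H : Type*} [NormedAddCommGroup H] [InnerProductSpace ℂ H]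

/-- The norm of a self-adjoint operator is its spectral radius, and the non-zero spectrum of a
compact operator consists of eigenvalues. -/
theorem norm_le_of_forall_hasEigenvalue [CompleteSpace H] {S : H →L[ℂ] H} (hS : IsCompactOperator S)
    (hS' : S.IsSymmetric) {c : ℝ} (hc : 0 ≤ c)
    (h : ∀ z : ℂ, z ≠ 0 → Module.End.HasEigenvalue (S : Module.End ℂ H) z → ‖z‖ ≤ c) :
    ‖S‖ ≤ c := by
  have h1 : spectralRadius ℂ S ≤ ENNReal.ofReal c := by
    refine iSup₂_le fun z hz => ?_
    change ‖z‖ₑ ≤ _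
    rw [← ofReal_norm]
    refine ENNReal.ofReal_le_ofReal ?_
    by_cases hz0 : z = 0
    · simpa [hz0] using hc
    · exact h z hz0 ((hS.hasEigenvalue_iff_mem_spectrum hz0).2 hz)
  rw [S.spectralRadius_eq_nnnorm hS'.isSelfAdjoint, ← enorm_eq_nnnorm, ← ofReal_norm,
    ENNReal.ofReal_le_ofReal_iff hc] at h1
  exact h1

variable {X : Type*} [TopologicalSpace X] [CompactSpace X]

/-- The coefficients `x ↦ ⟪v x, A⟫` of a vector `A`, for a continuous family `v`. -/
noncomputable def coeffMap (v : C(X, H)) : H →L[ℂ] C(X, ℂ) :=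
  LinearMap.mkContinuous
    { toFun := fun A => ⟨fun x => inner ℂ (v x) A, by fun_prop⟩
      map_add' := fun A B => by ext x; simp
      map_smul' := fun c A => by ext x; simp } ‖v‖ fun A => by
    rw [ContinuousMap.norm_le _ (by positivity)]
    intro x
    exact (norm_inner_le_norm _ _).trans (by gcongr; exact v.norm_coe_le_norm x)

@[simp]
theorem coeffMap_apply (v : C(X, H)) (A : H) (x : X) : coeffMap v A x = inner ℂ (v x) A := rfl

/-- Arzelà–Ascoli: on the unit ball the coefficients are bounded by `‖v‖`, and they are
equicontinuous because `v` is continuous in norm. -/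
theorem isCompactOperator_coeffMap (v : C(X, H)) : IsCompactOperator (coeffMap v) := by
  refine (isCompactOperator_iff_isCompact_closure_image_closedBall
    (coeffMap v).toLinearMap one_pos).2 ?_
  let e' := ContinuousMap.isometryEquivBoundedOfCompact X ℂ
  have h1 : IsCompact (closure (e' '' (coeffMap v '' Metric.closedBall 0 1))) := by
    refine BoundedContinuousFunction.arzela_ascoli (Metric.closedBall 0 ‖v‖)
      (isCompact_closedBall _ _) _ ?_ ?_
    · rintro _ x ⟨_, ⟨A, hA, rfl⟩, rfl⟩
      rw [mem_closedBall_zero_iff] at hA ⊢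
      change ‖inner ℂ (v x) A‖ ≤ _
      refine (norm_inner_le_norm _ _).trans ?_
      calc ‖v x‖ * ‖A‖ ≤ ‖v‖ * 1 := by gcongr; exact v.norm_coe_le_norm x
        _ = ‖v‖ := mul_one _
    · intro x
      rw [Metric.equicontinuousAt_iff_right]
      intro ε hε
      filter_upwards [Metric.tendsto_nhds.1 (v.continuous.tendsto x) ε hε] with y hy
      rintro ⟨_, ⟨_, ⟨A, hA, rfl⟩, rfl⟩⟩
      rw [mem_closedBall_zero_iff] at hA
      change dist (inner ℂ (v x) A) (inner ℂ (v y) A) < ε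
      rw [dist_eq_norm, ← inner_sub_left]
      refine (norm_inner_le_norm _ _).trans_lt ?_
      rw [dist_comm, dist_eq_norm] at hy
      calc ‖v x - v y‖ * ‖A‖ ≤ ‖v x - v y‖ * 1 := by gcongr
        _ < ε := by simpa using hy
  rw [← e'.toHomeomorph.isCompact_image, e'.toHomeomorph.image_closure]
  exact h1

end Hilbert

/-! ### Small invariant subspaces are fixed pointwise -/

section Representation

variable {G : Type*} [Group G] [TopologicalSpace G]
  {H : Type*} [NormedAddCommGroup H] [InnerProductSpace ℂ H]

/-- In an orthonormal basis of `E` the action becomes a continuous homomorphism to unitary matrices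
of size below `D`, which quasirandomness makes trivial. -/
theorem IsQuasirandom.isFixed_of_finrank_lt {D : ℝ} (hG : IsQuasirandom G D)
    (τ : G →* (H →ₗᵢ[ℂ] H)) (hτ : ∀ A, Continuous fun g => τ g A)
    (E : Submodule ℂ H) [FiniteDimensional ℂ E] (hE : ∀ g, ∀ A ∈ E, τ g A ∈ E)
    (hD : (Module.finrank ℂ E : ℝ) < D) (g : G) {A : H} (hA : A ∈ E) : τ g A = A := by
  let b := stdOrthonormalBasis ℂ E
  have hsum (A : H) (hA : A ∈ E) : ∑ l, inner ℂ (b l : H) A • (b l : H) = A := by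
    have h := congrArg Subtype.val (b.sum_repr' ⟨A, hA⟩)
    simpa using h
  let M (g : G) : Matrix (Fin (Module.finrank ℂ E)) (Fin (Module.finrank ℂ E)) ℂ :=
    Matrix.of fun i j => inner ℂ (b i : H) (τ g (b j : H))
  have hM1 : M 1 = 1 := by
    ext i j
    have := orthonormal_iff_ite.1 b.orthonormal i j
    simpa [M, Matrix.one_apply] using this
  have hMmul (g h : G) : M (g * h) = M g * M h := by
    ext i j
    simp only [M, Matrix.mul_apply, Matrix.of_apply, map_mul]
    change inner ℂ (b i : H) (τ g (τ h (b j : H))) = _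
    conv_lhs => rw [← hsum (τ h (b j : H)) (hE h _ (b j).2)]
    simp only [map_sum, map_smul, inner_sum, inner_smul_right]
    exact Finset.sum_congr rfl fun l _ => mul_comm _ _
  have hinv (g : G) (A : H) : τ g (τ g⁻¹ A) = A := by
    change (τ g * τ g⁻¹) A = A
    rw [← map_mul, mul_inv_cancel, map_one]
    rfl
  have hMstar (g : G) : star (M g) = M g⁻¹ := by
    ext i j
    simp only [M, Matrix.star_apply, Matrix.of_apply, RCLike.star_def, inner_conj_symm]
    conv_lhs => rw [← hinv g (b j : H)]
    exact (τ g).inner_map_map _ _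
  let ρ : G →* Matrix.unitaryGroup (Fin (Module.finrank ℂ E)) ℂ :=
    { toFun := fun g => ⟨M g, by
        rw [Matrix.mem_unitaryGroup_iff, hMstar, ← hMmul, mul_inv_cancel, hM1]⟩
      map_one' := Subtype.ext hM1
      map_mul' := fun g h => Subtype.ext (hMmul g h) }
  have hρ : Continuous ρ := by
    refine Continuous.subtype_mk ?_ _
    refine continuous_matrix fun i j => ?_
    exact Continuous.inner continuous_const (hτ _)
  have hM (g : G) : M g = 1 := congrArg Subtype.val (hG _ hD ρ hρ g)
  have hb (j) : τ g (b j : H) = b j := by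
    rw [← hsum (τ g (b j : H)) (hE g _ (b j).2)]
    have h1 (l) : inner ℂ (b l : H) (τ g (b j : H)) = if l = j then 1 else 0 := by
      rw [← Matrix.one_apply, ← hM g]
      rfl
    simp [h1]
  rw [← hsum A hA]
  simp [map_sum, hb]

end Representation

/-! ### The operator with kernel $\overline{u(xy)}$ and its spectrum -/

section Convolution

variable {G : Type*} [Group G] [TopologicalSpace G] [IsTopologicalGroup G] [CompactSpace G]
  [MeasurableSpace G] [BorelSpace G] {μ : Measure G} [IsProbabilityMeasure μ]

/-- The left translate `y ↦ u (x * y)`, as an element of `L²`. -/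
noncomputable def translateLp (μ : Measure G) [IsProbabilityMeasure μ] (u : C(G, ℂ)) :
    C(G, Lp ℂ 2 μ) where
  toFun x := ContinuousMap.toLp 2 μ ℂ ⟨fun y => u (x * y), by fun_prop⟩
  continuous_toFun := (ContinuousMap.toLp 2 μ ℂ).continuous.comp
    (ContinuousMap.curry ⟨fun q : G × G => u (q.1 * q.2), by fun_prop⟩).continuous

theorem translateLp_apply (u : C(G, ℂ)) (x : G) :
    translateLp μ u x = ContinuousMap.toLp 2 μ ℂ ⟨fun y => u (x * y), by fun_prop⟩ := rfl

/-- The integral operator on `L²` with kernel `conj (u (x * y))`. -/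
noncomputable def kernelOp (μ : Measure G) [IsProbabilityMeasure μ] (u : C(G, ℂ)) :
    Lp ℂ 2 μ →L[ℂ] Lp ℂ 2 μ :=
  (ContinuousMap.toLp 2 μ ℂ).comp (coeffMap (translateLp μ u))

theorem isCompactOperator_kernelOp (u : C(G, ℂ)) : IsCompactOperator (kernelOp μ u) :=
  (isCompactOperator_coeffMap (translateLp μ u)).clm_comp (ContinuousMap.toLp 2 μ ℂ)

theorem inner_kernelOp (u : C(G, ℂ)) (A B : Lp ℂ 2 μ) :
    inner ℂ (kernelOp μ u A) (kernelOp μ u B) =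
      ∫ x, inner ℂ (translateLp μ u x) B *
        starRingEnd ℂ (inner ℂ (translateLp μ u x) A) ∂μ :=
  ContinuousMap.inner_toLp μ _ _

theorem norm_sq_kernelOp (u : C(G, ℂ)) (A : Lp ℂ 2 μ) :
    ‖kernelOp μ u A‖ ^ 2 = ∫ x, ‖inner ℂ (translateLp μ u x) A‖ ^ 2 ∂μ := by
  have h := inner_kernelOp (μ := μ) u A A
  simp only [RCLike.mul_conj] at h
  rw [inner_self_eq_norm_sq_to_K] at h
  exact_mod_cast h

/-- The positive operator `T† T` for `T` the integral operator with kernel `conj (u (x * y))`. -/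
noncomputable def kernelSq (μ : Measure G) [IsProbabilityMeasure μ] (u : C(G, ℂ)) :
    Lp ℂ 2 μ →L[ℂ] Lp ℂ 2 μ :=
  (ContinuousLinearMap.adjoint (kernelOp μ u)).comp (kernelOp μ u)

theorem inner_kernelSq (u : C(G, ℂ)) (A B : Lp ℂ 2 μ) :
    inner ℂ (kernelSq μ u A) B = inner ℂ (kernelOp μ u A) (kernelOp μ u B) := by
  rw [kernelSq, ContinuousLinearMap.comp_apply, ContinuousLinearMap.adjoint_inner_left]

theorem isCompactOperator_kernelSq (u : C(G, ℂ)) : IsCompactOperator (kernelSq μ u) :=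
  (isCompactOperator_kernelOp u).clm_comp (ContinuousLinearMap.adjoint (kernelOp μ u))

theorem norm_sq_kernelOp_of_mem_eigenspace (u : C(G, ℂ)) {z : ℂ} {A : Lp ℂ 2 μ}
    (hA : kernelSq μ u A = z • A) : ‖kernelOp μ u A‖ ^ 2 = ‖z‖ * ‖A‖ ^ 2 := by
  have h := inner_kernelSq u A A
  rw [hA, inner_smul_left] at h
  have h' := congrArg norm h
  simpa using h'.symm

variable [μ.IsHaarMeasure]

theorem isMulRightInvariant_of_isProbabilityMeasure (μ : Measure G) [μ.IsHaarMeasure]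
    [IsProbabilityMeasure μ] : μ.IsMulRightInvariant where
  map_mul_right_eq_self g := by
    have h : Continuous (MulAut.conj g⁻¹).toMonoidHom := by
      change Continuous fun x => g⁻¹ * x * g⁻¹⁻¹
      fun_prop
    have h1 := MonoidHom.measurePreserving (μ := μ) (ν := μ) h (MulAut.conj g⁻¹).surjective rfl
    have h2 := (measurePreserving_mul_left μ g).comp h1
    convert h2.map_eq using 2
    funext x
    simp [mul_assoc]

/-- Left translation on `L²`. -/
noncomputable def leftTranslate (μ : Measure G) [μ.IsHaarMeasure] :
    G →* (Lp ℂ 2 μ →ₗᵢ[ℂ] Lp ℂ 2 μ) where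
  toFun g :=
    { toFun := fun A => DomMulAct.mk g⁻¹ • A
      map_add' := fun A B => smul_add _ A B
      map_smul' := fun c A => smul_comm _ c A
      norm_map' := fun A => DomMulAct.norm_smul_Lp _ A }
  map_one' := by
    ext1 A
    change DomMulAct.mk (1 : G)⁻¹ • A = A
    simp
  map_mul' g h := by
    ext1 A
    change DomMulAct.mk (g * h)⁻¹ • A = DomMulAct.mk g⁻¹ • DomMulAct.mk h⁻¹ • A
    rw [smul_smul, mul_inv_rev, DomMulAct.mk_mul]

theorem continuous_leftTranslate (A : Lp ℂ 2 μ) : Continuous fun g => leftTranslate μ g A := by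
  have : Fact ((2 : ENNReal) ≠ ⊤) := ⟨by simp⟩
  have h : Continuous fun g : G => DomMulAct.mk g⁻¹ :=
    DomMulAct.continuous_mk.comp continuous_inv
  exact h.smul continuous_const

theorem leftTranslate_translateLp (u : C(G, ℂ)) (g x : G) :
    leftTranslate μ g (translateLp μ u (x * g)) = translateLp μ u x := by
  refine Lp.ext ?_
  rw [translateLp_apply, translateLp_apply]
  change (DomMulAct.mk g⁻¹ • ContinuousMap.toLp 2 μ ℂ _ : Lp ℂ 2 μ) =ᵐ[μ] _
  filter_upwards [DomMulAct.smul_Lp_ae_eq (DomMulAct.mk g⁻¹)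
      (ContinuousMap.toLp 2 μ ℂ ⟨fun y => u (x * g * y), by fun_prop⟩),
    (measurePreserving_mul_left μ g⁻¹).quasiMeasurePreserving.ae
      (ContinuousMap.coeFn_toLp (p := 2) (𝕜 := ℂ) μ ⟨fun y => u (x * g * y), by fun_prop⟩),
    ContinuousMap.coeFn_toLp (p := 2) (𝕜 := ℂ) μ ⟨fun y => u (x * y), by fun_prop⟩]
    with y h1 h2 h3
  rw [h1, h3]
  refine h2.trans ?_
  simp [mul_assoc]

theorem inner_translateLp_leftTranslate (u : C(G, ℂ)) (g x : G) (A : Lp ℂ 2 μ) :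
    inner ℂ (translateLp μ u x) (leftTranslate μ g A) = inner ℂ (translateLp μ u (x * g)) A := by
  rw [← leftTranslate_translateLp u g x]
  exact (leftTranslate μ g).inner_map_map _ _

/-- Left translation of `A` by `g` becomes right translation of its image: $T(L_g A)(x) = (TA)(xg)$.
Right invariance of Haar measure finishes. -/
theorem inner_kernelOp_leftTranslate (u : C(G, ℂ)) (g : G) (A B : Lp ℂ 2 μ) :
    inner ℂ (kernelOp μ u (leftTranslate μ g A)) (kernelOp μ u (leftTranslate μ g B)) =
      inner ℂ (kernelOp μ u A) (kernelOp μ u B) := by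
  have := isMulRightInvariant_of_isProbabilityMeasure μ
  simp only [inner_kernelOp, inner_translateLp_leftTranslate]
  exact integral_mul_right_eq_self (fun x => inner ℂ (translateLp μ u x) B *
        starRingEnd ℂ (inner ℂ (translateLp μ u x) A)) g

/-- The integral is the inner product of $TA$ with the constant 1, hence continuous in `A`. It
therefore suffices to treat continuous `A`, where Fubini and $\int u = 0$ apply. -/
theorem integral_inner_translateLp (u : C(G, ℂ)) (hu : ∫ x, u x ∂μ = 0) (A : Lp ℂ 2 μ) :
    ∫ x, inner ℂ (translateLp μ u x) A ∂μ = 0 := by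
  have := isMulRightInvariant_of_isProbabilityMeasure μ
  have h (A : Lp ℂ 2 μ) : ∫ x, inner ℂ (translateLp μ u x) A ∂μ =
      inner ℂ (ContinuousMap.toLp 2 μ ℂ 1) (kernelOp μ u A) := by
    refine Eq.trans ?_ (ContinuousMap.inner_toLp μ _ _).symm
    simp
  rw [h]
  refine (ContinuousMap.toLp_denseRange (p := 2) ℂ μ ℂ (by simp)).induction_on
    (p := fun A => inner ℂ (ContinuousMap.toLp 2 μ ℂ 1) (kernelOp μ u A) = 0) A
    (isClosed_eq (by fun_prop) continuous_const) fun a => ?_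
  rw [← h]
  simp only [translateLp_apply, ContinuousMap.inner_toLp, ContinuousMap.coe_mk]
  rw [integral_integral_swap_of_hasCompactSupport (by unfold Function.uncurry; fun_prop)
    (HasCompactSupport.of_compactSpace _)]
  simp only [integral_const_mul, integral_conj]
  simp [integral_mul_right_eq_self, hu]

/-- If `A` is fixed, $TA$ is constant, and its mean is zero. -/
theorem kernelOp_eq_zero_of_isFixed (u : C(G, ℂ)) (hu : ∫ x, u x ∂μ = 0) {A : Lp ℂ 2 μ}
    (hA : ∀ g, leftTranslate μ g A = A) : kernelOp μ u A = 0 := by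
  have h1 (x : G) : inner ℂ (translateLp μ u x) A = inner ℂ (translateLp μ u 1) A := by
    conv_rhs => rw [← hA x, inner_translateLp_leftTranslate, one_mul]
  have h2 := integral_inner_translateLp u hu A
  simp only [h1, integral_const, probReal_univ, one_smul] at h2
  have h3 := norm_sq_kernelOp u A
  simpa [h1, h2] using h3

theorem kernelSq_leftTranslate (u : C(G, ℂ)) (g : G) (A : Lp ℂ 2 μ) :
    kernelSq μ u (leftTranslate μ g A) = leftTranslate μ g (kernelSq μ u A) := by
  refine ext_inner_right ℂ fun B => ?_
  have hB : B = leftTranslate μ g (leftTranslate μ g⁻¹ B) := by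
    change B = (leftTranslate μ g * leftTranslate μ g⁻¹) B
    rw [← map_mul, mul_inv_cancel, map_one]
    rfl
  conv_lhs => rw [hB, inner_kernelSq, inner_kernelOp_leftTranslate, ← inner_kernelSq]
  conv_rhs => rw [hB, (leftTranslate μ g).inner_map_map]

/-- A Hilbert–Schmidt bound: $\sum_i \|T e_i\|^2$ is the integral over `x` of the squared
coefficients of the `x`-translate of `u`, which Bessel bounds by its squared norm. -/
theorem card_mul_norm_le {n : ℕ} (u : C(G, ℂ)) (hu : ∀ x, ‖translateLp μ u x‖ ^ 2 ≤ 1)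
    {e : Fin n → Lp ℂ 2 μ} (he : Orthonormal ℂ e) {z : ℂ} (hz : ∀ i, kernelSq μ u (e i) = z • e i) :
    n * ‖z‖ ≤ 1 := by
  have hc (i : Fin n) : Continuous fun x => ‖inner ℂ (translateLp μ u x) (e i)‖ ^ 2 := by fun_prop
  calc n * ‖z‖ = ∑ i : Fin n, ‖kernelOp μ u (e i)‖ ^ 2 := by
        simp [norm_sq_kernelOp_of_mem_eigenspace u (hz _), he.1]
    _ = ∫ x, ∑ i : Fin n, ‖inner ℂ (translateLp μ u x) (e i)‖ ^ 2 ∂μ := by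
        simp only [norm_sq_kernelOp]
        refine (integral_finsetSum _ fun i _ => ?_).symm
        exact (hc i).integrable_of_hasCompactSupport (HasCompactSupport.of_compactSpace _)
    _ ≤ ∫ _, (1 : ℝ) ∂μ := by
        refine integral_mono ?_ (integrable_const _) fun x => ?_
        · exact (continuous_finsetSum _ fun i _ => hc i).integrable_of_hasCompactSupport
            (HasCompactSupport.of_compactSpace _)
        · refine le_trans ?_ (hu x)
          simp only [norm_inner_symm (translateLp μ u x)]
          exact he.sum_inner_products_le _
    _ = 1 := by simp

/-- The eigenspace is translation-invariant. Were its dimension below `D`, its vectors would be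
fixed and so killed by $T$, contradicting $z \ne 0$. Multiplicity at least `D` then forces the
bound. -/
theorem IsQuasirandom.norm_eigenvalue_kernelSq_le {D : ℝ} (hD : 0 < D) (hG : IsQuasirandom G D)
    (u : C(G, ℂ)) (hu0 : ∫ x, u x ∂μ = 0) (hu : ∀ x, ‖translateLp μ u x‖ ^ 2 ≤ 1) {z : ℂ}
    (hz0 : z ≠ 0) (hz : Module.End.HasEigenvalue (kernelSq μ u : Module.End ℂ (Lp ℂ 2 μ)) z) :
    ‖z‖ ≤ 1 / D := by
  let E := Module.End.eigenspace (kernelSq μ u).toLinearMap z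
  have hE {A : Lp ℂ 2 μ} : A ∈ E ↔ kernelSq μ u A = z • A := Module.End.mem_eigenspace_iff
  have : FiniteDimensional ℂ E :=
    ContinuousLinearMap.finite_dimensional_eigenspace (isCompactOperator_kernelSq u) z hz0
  have h1 : Module.finrank ℂ E * ‖z‖ ≤ 1 := by
    let b := stdOrthonormalBasis ℂ E
    exact card_mul_norm_le u hu (e := fun i => (b i : Lp ℂ 2 μ))
      (b.orthonormal.comp_linearIsometry E.subtypeₗᵢ) fun i => hE.1 (b i).2
  have h2 : D ≤ Module.finrank ℂ E := by
    by_contra! hlt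
    obtain ⟨A, hAE, hA0⟩ := hz.exists_hasEigenvector
    have h3 := kernelOp_eq_zero_of_isFixed u hu0 fun g =>
      hG.isFixed_of_finrank_lt (leftTranslate μ) continuous_leftTranslate E
        (fun g A hA => hE.2 (by rw [kernelSq_leftTranslate, hE.1 hA, map_smul])) hlt g hAE
    have h4 := norm_sq_kernelOp_of_mem_eigenspace u (hE.1 hAE)
    rw [h3] at h4
    simp [hz0, hA0] at h4
  rw [le_div_iff₀ hD, mul_comm]
  exact le_trans (by gcongr) h1

theorem IsQuasirandom.norm_sq_kernelOp_le {D : ℝ} (hD : 0 < D) (hG : IsQuasirandom G D)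
    (u : C(G, ℂ)) (hu0 : ∫ x, u x ∂μ = 0) (hu : ∀ x, ‖translateLp μ u x‖ ^ 2 ≤ 1)
    (A : Lp ℂ 2 μ) : ‖kernelOp μ u A‖ ^ 2 ≤ 1 / D * ‖A‖ ^ 2 := by
  have hS : ‖kernelSq μ u‖ ≤ 1 / D :=
    norm_le_of_forall_hasEigenvalue (isCompactOperator_kernelSq u)
      (fun A B => by
        change inner ℂ (kernelSq μ u A) B = inner ℂ A (kernelSq μ u B)
        rw [inner_kernelSq, ← inner_conj_symm A, inner_kernelSq, inner_conj_symm])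
      (by positivity) fun z hz0 hz => hG.norm_eigenvalue_kernelSq_le hD u hu0 hu hz0 hz
  have h := congrArg norm (inner_kernelSq u A A)
  rw [inner_self_eq_norm_sq_to_K] at h
  simp only [norm_pow, Complex.coe_algebraMap, Complex.norm_real, norm_norm] at h
  rw [← h]
  calc ‖inner ℂ (kernelSq μ u A) A‖ ≤ ‖kernelSq μ u A‖ * ‖A‖ := norm_inner_le_norm _ _
    _ ≤ (1 / D * ‖A‖) * ‖A‖ := by gcongr; exact (kernelSq μ u).le_of_opNorm_le hS A
    _ = 1 / D * ‖A‖ ^ 2 := by ring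

end Convolution

/-! ### Mixing in quasirandom groups -/

section Mixing

variable {G : Type*} [Group G] [TopologicalSpace G] [IsTopologicalGroup G] [CompactSpace G]

theorem norm_sq_toLp {X : Type*} [TopologicalSpace X] [CompactSpace X] [MeasurableSpace X]
    [BorelSpace X] (μ : Measure X) [IsProbabilityMeasure μ]
    (a : C(X, ℂ)) : ‖ContinuousMap.toLp 2 μ ℂ a‖ ^ 2 = ∫ x, ‖a x‖ ^ 2 ∂μ := by
  have h := ContinuousMap.inner_toLp μ a a
  simp only [RCLike.mul_conj] at h
  rw [inner_self_eq_norm_sq_to_K] at h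
  exact_mod_cast h

theorem norm_sq_toLp_ofReal [MeasurableSpace G] [BorelSpace G] {a : G → ℝ} (ha : Continuous a) :
    ‖ContinuousMap.toLp 2 (Measure.haarMeasure (⊤ : TopologicalSpace.PositiveCompacts G)) ℂ
      ⟨fun x => (a x : ℂ), by fun_prop⟩‖ ^ 2 = avg fun x => a x ^ 2 := by
  have := isProbabilityMeasure_haarMeasure_top (X := G)
  rw [norm_sq_toLp, avg_eq_integral]
  simp

theorem IsQuasirandom.sq_avg_mul_le {D : ℝ} (hD : 0 < D) (hG : IsQuasirandom G D)
    {A B u : G → ℝ} (hA : Continuous A) (hB : Continuous B) (hu : Continuous u)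
    (hA1 : ∀ x, |A x| ≤ 1) (hB1 : ∀ x, |B x| ≤ 1) (hu0 : avg u = 0)
    (hu1 : (avg fun x => u x ^ 2) ≤ 1) :
    (avg fun s => avg fun t => A s * B t * u (s * t)) ^ 2 ≤ 1 / D := by
  let : MeasurableSpace G := borel G
  have : BorelSpace G := ⟨rfl⟩
  have := isProbabilityMeasure_haarMeasure_top (X := G)
  let μ := Measure.haarMeasure (⊤ : TopologicalSpace.PositiveCompacts G)
  let a : C(G, ℂ) := ⟨fun x => (A x : ℂ), by fun_prop⟩
  let b : C(G, ℂ) := ⟨fun x => (B x : ℂ), by fun_prop⟩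
  let w : C(G, ℂ) := ⟨fun x => (u x : ℂ), by fun_prop⟩
  have hw0 : ∫ x, w x ∂μ = 0 := by
    change ∫ x, (u x : ℂ) ∂μ = 0
    rw [integral_complex_ofReal, ← avg_eq_integral, hu0]
    rfl
  have hw1 (x : G) : ‖translateLp μ w x‖ ^ 2 ≤ 1 := by
    refine le_trans (le_of_eq ?_) hu1
    rw [← avg_mul_left _ x]
    exact norm_sq_toLp_ofReal (a := fun y => u (x * y)) (by fun_prop)
  have hle {F : G → ℝ} (hF : Continuous F) (hF1 : ∀ x, |F x| ≤ 1) :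
      (avg fun x => F x ^ 2) ≤ 1 :=
    avg_le_of_le (by fun_prop) fun x => (sq_le_one_iff_abs_le_one _).2 (hF1 x)
  have ha : ‖ContinuousMap.toLp 2 μ ℂ a‖ ^ 2 ≤ 1 := (norm_sq_toLp_ofReal hA).trans_le (hle hA hA1)
  have hb : ‖ContinuousMap.toLp 2 μ ℂ b‖ ^ 2 ≤ 1 := (norm_sq_toLp_ofReal hB).trans_le (hle hB hB1)
  -- The double mean is the matrix coefficient $\langle a, Tb \rangle$, so the operator bound
  -- applies.
  have key : inner ℂ (ContinuousMap.toLp 2 μ ℂ a) (kernelOp μ w (ContinuousMap.toLp 2 μ ℂ b)) =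
      ((avg fun s => avg fun t => A s * B t * u (s * t) : ℝ) : ℂ) := by
    refine (ContinuousMap.inner_toLp μ _ _).trans ?_
    change ∫ s, inner ℂ (ContinuousMap.toLp 2 μ ℂ ⟨fun t => w (s * t), by fun_prop⟩)
      (ContinuousMap.toLp 2 μ ℂ b) * starRingEnd ℂ (a s) ∂μ = _
    simp only [ContinuousMap.inner_toLp]
    simp only [avg_eq_integral, ← integral_complex_ofReal, ← integral_mul_const]
    congr 1
    funext s
    congr 1
    funext t
    simp [a, b, w]
    ring
  have h1 := norm_inner_le_norm (𝕜 := ℂ) (ContinuousMap.toLp 2 μ ℂ a)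
    (kernelOp μ w (ContinuousMap.toLp 2 μ ℂ b))
  rw [key, Complex.norm_real, Real.norm_eq_abs] at h1
  have h2 := hG.norm_sq_kernelOp_le hD w hw0 hw1 (ContinuousMap.toLp 2 μ ℂ b)
  rw [← sq_abs]
  calc |avg fun s => avg fun t => A s * B t * u (s * t)| ^ 2
      ≤ ‖ContinuousMap.toLp 2 μ ℂ a‖ ^ 2 * ‖kernelOp μ w (ContinuousMap.toLp 2 μ ℂ b)‖ ^ 2 := by
        rw [← mul_pow]
        gcongr
    _ ≤ 1 * (1 / D * 1) := by
        gcongr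
        exact h2.trans (by gcongr)
    _ = 1 / D := by ring

/-- In a `D`-quasirandom group, the value of `s * t` is almost independent of `s` and `t`. -/
theorem IsQuasirandom.abs_avg_mul_le {D : ℝ} (hD : 0 < D) (hG : IsQuasirandom G D)
    {A B u : G → ℝ} (hA : Continuous A) (hB : Continuous B) (hu : Continuous u)
    (hA1 : ∀ x, |A x| ≤ 1) (hB1 : ∀ x, |B x| ≤ 1) (hu1 : ∀ x, |u x| ≤ 1) :
    |avg fun s => avg fun t => A s * B t * u (s * t)| ≤
      |avg A| * |avg B| + D ^ (-((1 : ℝ) / 2)) := by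
  -- Subtracting the mean of `u` leaves a function of variance at most 1, to which the spectral
  -- bound applies; the mean itself yields the main term.
  have h1 : (avg fun x => (u x - avg u) ^ 2) ≤ 1 := by
    have h2 : (avg fun x => (u x - avg u) ^ 2) = (avg fun x => u x ^ 2) - avg u ^ 2 := by
      have h3 (x : G) : (u x - avg u) ^ 2 = (u x ^ 2 - 2 * avg u * u x) + avg u ^ 2 := by ring
      simp only [h3]
      rw [avg_add (by fun_prop) (by fun_prop), avg_sub (by fun_prop) (by fun_prop),
        avg_const_mul, avg_const]
      ring
    have h4 : (avg fun x => u x ^ 2) ≤ 1 :=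
      avg_le_of_le (by fun_prop) fun x => (sq_le_one_iff_abs_le_one _).2 (hu1 x)
    nlinarith [sq_nonneg (avg u)]
  have h5 := hG.sq_avg_mul_le hD hA hB (u := fun x => u x - avg u) (by fun_prop) hA1 hB1
    (by rw [avg_sub hu continuous_const, avg_const, sub_self]) h1
  have h6 : (avg fun s => avg fun t => A s * B t * u (s * t)) =
      (avg fun s => avg fun t => A s * B t * (u (s * t) - avg u)) + avg A * avg B * avg u := by
    have h7 (s t : G) : A s * B t * u (s * t) =
        A s * B t * (u (s * t) - avg u) + A s * B t * avg u := by ring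
    simp only [h7]
    have h8 (s : G) : (avg fun t => A s * B t * (u (s * t) - avg u) + A s * B t * avg u) =
        (avg fun t => A s * B t * (u (s * t) - avg u)) + avg fun t => A s * B t * avg u :=
      avg_add (by fun_prop) (by fun_prop)
    simp only [h8]
    rw [avg_add (continuous_avg (by fun_prop)) (continuous_avg (by fun_prop))]
    simp only [avg_mul_const, avg_const_mul]
  rw [h6]
  refine (abs_add_le _ _).trans ?_
  rw [add_comm]
  gcongr
  · rw [abs_mul, abs_mul]
    exact mul_le_of_le_one_right (by positivity) (abs_avg_le_of_abs_le hu hu1)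
  · rw [Real.rpow_neg hD.le, ← Real.sqrt_eq_rpow, ← Real.sqrt_inv, ← one_div]
    exact Real.abs_le_sqrt h5

end Mixing

/-! ### Iterated Cauchy–Schwarz for box norms -/

section BoxCauchySchwarz

universe u

variable {G : Type u} [Group G] [TopologicalSpace G] [IsTopologicalGroup G] [CompactSpace G]

theorem sq_avg_eq {F : G → ℝ} (hF : Continuous F) :
    avg F ^ 2 = avg fun q : G × G => F q.1 * F q.2 := by
  rw [avg_prod (by fun_prop)]
  simp only [avg_const_mul, avg_mul_const]
  ring

/-- The Cauchy–Schwarz inequality for box norms, with parameters in a compact group `P`. -/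
theorem pow_avg_mul_prod_le (n : ℕ) {P : Type u} [Group P] [TopologicalSpace P]
    [IsTopologicalGroup P] [CompactSpace P] {Ψ : (Fin n → G) × P → ℝ}
    {F : Fin n → (Fin n → G) × P → ℝ} (hΨ : Continuous Ψ) (hF : ∀ j, Continuous (F j))
    (hF1 : ∀ j q, |F j q| ≤ 1)
    (hF2 : ∀ j p y y', (∀ l, l ≠ j → y l = y' l) → F j (y, p) = F j (y', p)) :
    (avg fun p => avg fun y => Ψ (y, p) * ∏ j, F j (y, p)) ^ 2 ^ n ≤
      avg fun p => avg fun z : Fin n × Bool → G =>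
        ∏ ε : Fin n → Bool, Ψ (fun j => z (j, ε j), p) := by
  induction n generalizing P with
  | zero =>
    have h (y : Fin 0 → G) (p : P) : Ψ (y, p) = Ψ (1, p) := by
      rw [Subsingleton.elim y 1]
    simp [h, avg_const]
  | succ n ih =>
    let Φ (s : G) (y : Fin n → G) (p : P) : ℝ :=
      Ψ (Fin.insertNth 0 s y, p) * ∏ j : Fin n, F (Fin.succAbove 0 j) (Fin.insertNth 0 s y, p)
    have hΦ : Continuous fun q : G × (Fin n → G) × P => Φ q.1 q.2.1 q.2.2 := by
      unfold Φ
      fun_prop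
    have hΦ' : Continuous fun q : (Fin n → G) × P => avg fun s => Φ s q.1 q.2 :=
      continuous_avg (hΦ.comp (f := fun q : ((Fin n → G) × P) × G => (q.2, q.1.1, q.1.2))
        (by fun_prop))
    have hF0 (s : G) (y : Fin n → G) (p : P) :
        F 0 (Fin.insertNth 0 s y, p) = F 0 (Fin.insertNth 0 1 y, p) := by
      refine hF2 0 p _ _ fun l hl => ?_
      obtain ⟨l, rfl⟩ := Fin.exists_succAbove_eq hl
      simp
    have h1 : (avg fun p => avg fun y => Ψ (y, p) * ∏ j, F j (y, p)) =
        avg fun p => avg fun y => F 0 (Fin.insertNth 0 1 y, p) * avg fun s => Φ s y p := by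
      congr 1
      funext p
      rw [avg_insertNth 0 (by fun_prop)]
      congr 1
      funext y
      rw [← avg_const_mul]
      congr 1
      funext s
      rw [Fin.prod_univ_succAbove _ 0, hF0 s y p]
      ring
    let Ψ' (q : (Fin n → G) × (P × (G × G))) : ℝ :=
      Ψ (Fin.insertNth 0 q.2.2.1 q.1, q.2.1) * Ψ (Fin.insertNth 0 q.2.2.2 q.1, q.2.1)
    let F' (j : Fin n) (q : (Fin n → G) × (P × (G × G))) : ℝ :=
      F (Fin.succAbove 0 j) (Fin.insertNth 0 q.2.2.1 q.1, q.2.1) *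
        F (Fin.succAbove 0 j) (Fin.insertNth 0 q.2.2.2 q.1, q.2.1)
    have hΨ' : Continuous Ψ' := by unfold Ψ'; fun_prop
    have hF' (j) : Continuous (F' j) := by unfold F'; fun_prop
    -- `F 0` ignores the variable `s`, so it comes out of the mean over `s` and Cauchy–Schwarz
    -- discards it. Squaring that mean creates two copies of `s`, which join the parameters as the
    -- factor `G × G`.
    have h2 : (avg fun p => avg fun y => Ψ (y, p) * ∏ j, F j (y, p)) ^ 2 ≤
        avg fun p => avg fun y => Ψ' (y, p) * ∏ j, F' j (y, p) := by
      rw [h1]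
      have hc : Continuous fun q : P × (Fin n → G) =>
          F 0 (Fin.insertNth 0 1 q.2, q.1) * avg fun s => Φ s q.2 q.1 :=
        Continuous.mul (by fun_prop)
          (hΦ'.comp (f := fun q : P × (Fin n → G) => (q.2, q.1)) (by fun_prop))
      calc _ ≤ avg fun p => avg fun y => (avg fun s => Φ s y p) ^ 2 := by
            rw [← avg_prod hc, ← avg_prod (F := fun q : P × (Fin n → G) =>
              (avg fun s => Φ s q.2 q.1) ^ 2) ((hΦ'.comp continuous_swap).pow 2)]
            refine (sq_avg_le hc).trans (avg_mono (hc.pow 2) ((hΦ'.comp continuous_swap).pow 2)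
              fun q => ?_)
            rw [mul_pow]
            exact mul_le_of_le_one_left (sq_nonneg _)
              ((sq_le_one_iff_abs_le_one _).2 (hF1 _ _))
        _ = avg fun p => avg fun y => avg fun q : G × G =>
              Ψ' (y, (p, q)) * ∏ j, F' j (y, (p, q)) := by
            congr 1
            funext p
            congr 1
            funext y
            rw [sq_avg_eq (F := fun s => Φ s y p) (hΦ.comp (f := fun s => (s, y, p)) (by fun_prop))]
            congr 1
            funext q
            simp only [Φ, Ψ', F', Finset.prod_mul_distrib]
            ring
        _ = avg fun p => avg fun q : G × G => avg fun y =>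
              Ψ' (y, (p, q)) * ∏ j, F' j (y, (p, q)) := by
            congr 1
            funext p
            exact avg_comm (by fun_prop)
        _ = _ := (avg_prod (F := fun p => avg fun y => Ψ' (y, p) * ∏ j, F' j (y, p))
            (continuous_avg (by fun_prop))).symm
    have h3 := ih (P := P × (G × G)) hΨ' hF'
      (fun j q => by
        rw [abs_mul]
        exact mul_le_one₀ (hF1 _ _) (abs_nonneg _) (hF1 _ _))
      (fun j p y y' h => by
        have h4 (s : G) (l : Fin (n + 1)) (hl : l ≠ Fin.succAbove 0 j) :
            (Fin.insertNth 0 s y : Fin (n + 1) → G) l = (Fin.insertNth 0 s y' : _ → G) l := by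
          refine Fin.succAboveCases 0 (fun _ => ?_) (fun l hl => ?_) l hl
          · simp
          · have : l ≠ j := fun h => hl (by rw [h])
            simpa using h l this
        simp only [F']
        rw [hF2 _ _ _ _ (h4 p.2.1), hF2 _ _ _ _ (h4 p.2.2)])
    rw [pow_succ', pow_mul]
    refine (pow_le_pow_left₀ (sq_nonneg _) h2 _).trans (h3.trans (le_of_eq ?_))
    rw [avg_prod (continuous_avg (by fun_prop))]
    congr 1
    funext p
    rw [avg_insertPair 0 (by fun_prop)]
    simp only [prod_insertPair 0 fun y => Ψ (y, p)]
    rw [avg_comm (by fun_prop)]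
    conv_rhs => rw [avg_prod (by fun_prop)]

end BoxCauchySchwarz

/-! ### The change of variables and its invariance -/

section ChangeOfVariables

variable {G : Type*} [Group G] {k n : ℕ}

theorem side_insertNth_zero (s : G) (y : Fin k → G) :
    side (Fin.insertNth 0 s y : Fin (k + 1) → G) = s * (List.ofFn y).prod := by
  simp [side]

/-- The products `y_j ⋯ y_{k-1}`. -/
def suffixProd (y : Fin k → G) : Fin k → G := fun j => ((List.ofFn y).drop j.val).prod

theorem base_insertNth_zero (s : G) (y : Fin k → G) :
    base (Fin.insertNth 0 s y : Fin (k + 1) → G) = (suffixProd y)⁻¹ := by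
  funext j
  simp [base, suffixProd]

theorem suffixProd_insertNth_zero (t : G) (y : Fin k → G) :
    suffixProd (Fin.insertNth 0 t y : Fin (k + 1) → G) =
      Fin.insertNth 0 (t * (List.ofFn y).prod) (suffixProd y) := by
  funext j
  refine Fin.cases ?_ (fun j => ?_) j <;> simp [suffixProd]

/-- The two inserted variables are adjacent in the ordered product. This is what lets the weight
depend on them through $st$ alone. -/
theorem exists_side_insertNth_insertNth (p : Fin (n + 1)) (y : Fin n → G) :
    ∃ P Q : G, ∀ s t : G,
      side (p.castSucc.insertNth s (p.insertNth t y : Fin (n + 1) → G) : Fin (n + 2) → G) =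
        P * (s * t) * Q := by
  induction n with
  | zero =>
    obtain rfl : p = 0 := Fin.fin_one_eq_zero p
    refine ⟨1, 1, fun s t => ?_⟩
    simp [side]
  | succ n ih =>
    refine Fin.cases ?_ (fun p => ?_) p
    · refine ⟨1, (List.ofFn y).prod, fun s t => ?_⟩
      simp [side, mul_assoc]
    · obtain ⟨P, Q, h⟩ := ih p (Fin.tail y)
      refine ⟨y 0 * P, Q, fun s t => ?_⟩
      have h1 : (p.succ.insertNth t y : Fin (n + 2) → G) =
          Fin.cons (y 0) (p.insertNth t (Fin.tail y)) := by
        conv_lhs => rw [← Fin.cons_self_tail y, Fin.insertNth_succ_cons]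
      have h2 : (p.succ.castSucc.insertNth s
          (Fin.cons (y 0) (p.insertNth t (Fin.tail y)) : Fin (n + 2) → G) : Fin (n + 3) → G) =
          Fin.cons (y 0)
            (p.castSucc.insertNth s (p.insertNth t (Fin.tail y) : Fin (n + 1) → G)) := by
        rw [← Fin.succ_castSucc, Fin.insertNth_succ_cons]
      rw [h1, h2]
      have h3 (x : Fin (n + 2) → G) : side (Fin.cons (y 0) x : Fin (n + 3) → G) = y 0 * side x := by
        simp [side]
      rw [h3, h]
      simp only [mul_assoc]

/-- Either adjacent variable can be treated as the last one inserted, hence as the one that the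
corresponding `N` ignores. -/
theorem insertNth_insertNth_comm {α : Type*} (p : Fin (n + 1)) (s t : α) (y : Fin n → α) :
    (p.castSucc.insertNth s (p.insertNth t y : Fin (n + 1) → α) : Fin (n + 2) → α) =
      p.succ.insertNth t (p.insertNth s y : Fin (n + 1) → α) := by
  funext j
  refine Fin.succAboveCases p.castSucc ?_ (fun j => ?_) j
  · have : p.castSucc = p.succ.succAbove p := by simp
    rw [Fin.insertNth_apply_same, this, Fin.insertNth_apply_succAbove, Fin.insertNth_apply_same]
  · rw [Fin.insertNth_apply_succAbove]
    refine Fin.succAboveCases p ?_ (fun j => ?_) j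
    · simp
    · have : p.castSucc.succAbove (p.succAbove j) = p.succ.succAbove (p.succAbove j) := by
        simp only [Fin.succAbove, Fin.lt_def, Fin.ext_iff]
        split_ifs <;> simp_all <;> omega
      rw [this]
      simp

theorem N_insertNth (i : Fin (k + 1)) (f : (Fin k → G) → ℝ) (s : G) (y : Fin k → G) :
    N i f (i.insertNth s y) = omitVar i (N i f) y := by
  rw [N_eq_omitVar, Fin.removeNth_insertNth]

theorem shift_eq_mul (i : Fin (k + 1)) (g : G) (a : Fin k → G) :
    shift i g a = (fun j : Fin k => if j.val < i.val then g else 1) * a := by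
  funext j
  simp only [shift, Pi.mul_apply]
  split_ifs <;> simp

variable [TopologicalSpace G] [IsTopologicalGroup G]

theorem continuous_prod_ofFn : Continuous fun y : Fin k → G => (List.ofFn y).prod := by
  simp only [List.ofFn_eq_map]
  exact continuous_list_prod _ fun i _ => continuous_apply i

theorem continuous_prod_drop_ofFn (m : ℕ) :
    Continuous fun y : Fin k → G => ((List.ofFn y).drop m).prod := by
  simp only [List.ofFn_eq_map, ← List.map_drop]
  exact continuous_list_prod _ fun i _ => continuous_apply i

theorem continuous_suffixProd : Continuous (suffixProd : (Fin k → G) → _) :=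
  continuous_pi fun j => continuous_prod_drop_ofFn j.val

theorem continuous_side : Continuous (side : (Fin (k + 1) → G) → G) := continuous_prod_ofFn

theorem continuous_base : Continuous (base : (Fin (k + 1) → G) → _) :=
  continuous_pi fun j => (continuous_prod_drop_ofFn (j.val + 1)).inv

theorem continuous_shift (i : Fin (k + 1)) :
    Continuous fun q : G × (Fin k → G) => shift i q.1 q.2 := by
  refine continuous_pi fun j => ?_
  unfold shift
  split_ifs <;> fun_prop

theorem continuous_shift_side_base (i : Fin (k + 1)) :
    Continuous fun x : Fin (k + 1) → G => shift i (side x) (base x) :=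
  (continuous_shift i).comp (continuous_side.prodMk continuous_base)

variable [CompactSpace G]

/-- By induction: the first variable enters only the first suffix product, where the others merely
right-translate it. -/
theorem avg_suffixProd {Ψ : (Fin k → G) → ℝ} (hΨ : Continuous Ψ) :
    avg (fun y => Ψ (suffixProd y)) = avg Ψ := by
  induction k with
  | zero =>
    congr 1
    funext y
    rw [Subsingleton.elim (suffixProd y) y]
  | succ k ih =>
    rw [avg_insertNth 0 (F := fun y => Ψ (suffixProd y)) (hΨ.comp continuous_suffixProd),
      avg_insertNth 0 hΨ]
    simp only [suffixProd_insertNth_zero]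
    have h (y : Fin k → G) :
        (avg fun t => Ψ (Fin.insertNth 0 (t * (List.ofFn y).prod) (suffixProd y))) =
          avg fun t => Ψ (Fin.insertNth 0 t (suffixProd y)) :=
      avg_mul_right (F := fun t => Ψ (Fin.insertNth 0 t (suffixProd y))) (by fun_prop) _
    simp only [h]
    exact ih (Ψ := fun z => avg fun t => Ψ (Fin.insertNth 0 t z)) (continuous_avg (by fun_prop))

theorem avg_side_base {Φ : G × (Fin k → G) → ℝ} (hΦ : Continuous Φ) :
    avg (fun x => Φ (side x, base x)) = avg fun g => avg fun a => Φ (g, a) := by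
  rw [avg_insertNth 0 (F := fun x => Φ (side x, base x))
    (hΦ.comp (continuous_side.prodMk continuous_base))]
  simp only [side_insertNth_zero, base_insertNth_zero]
  have h (y : Fin k → G) : (avg fun s => Φ (s * (List.ofFn y).prod, (suffixProd y)⁻¹)) =
      avg fun s => Φ (s, (suffixProd y)⁻¹) :=
    avg_mul_right (F := fun s => Φ (s, (suffixProd y)⁻¹)) (by fun_prop) _
  simp only [h]
  rw [avg_suffixProd (Ψ := fun y => avg fun s => Φ (s, y⁻¹)) (continuous_avg (by fun_prop)),
    avg_inv (F := fun y => avg fun s => Φ (s, y)) (continuous_avg (by fun_prop))]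
  exact avg_comm (by fun_prop)

/-- Averaging over the ignored variable changes nothing. In the coordinates $(g, a)$, for fixed `g`
the shift is a left translation of $G^k$. -/
theorem avg_omitVar_N (i : Fin (k + 1)) {F : (Fin k → G) → ℝ} (hF : Continuous F) :
    avg (omitVar i (N i F)) = avg F := by
  have hN : Continuous (N i F) := hF.comp (continuous_shift_side_base i)
  have h1 := avg_side_base (hF.comp (continuous_shift i))
  have h2 := avg_insertNth i hN
  simp only [N_insertNth, avg_const] at h2
  rw [h2.symm]
  refine h1.trans ?_
  simp only [Function.comp_apply, shift_eq_mul, avg_mul_left, avg_const]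

end ChangeOfVariables

/-! ### The inequality for continuous functions -/

section ContinuousCase

universe u

variable {G : Type u} [Group G] {k n : ℕ}

theorem N_congr (i : Fin (k + 1)) (f : (Fin k → G) → ℝ) {x x' : Fin (k + 1) → G}
    (h : ∀ j, j ≠ i → x j = x' j) : N i f x = N i f x' := by
  rw [N_eq_omitVar, N_eq_omitVar i f x']
  congr 1
  funext j
  exact h _ (Fin.succAbove_ne i j)

theorem abs_prod_le_one {ι : Type*} (s : Finset ι) {F : ι → ℝ} (h : ∀ j, |F j| ≤ 1) :
    |∏ j ∈ s, F j| ≤ 1 := by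
  rw [Finset.abs_prod]
  exact Finset.prod_le_one (fun _ _ => abs_nonneg _) fun j _ => h j

theorem insertNth_insertNth_congr {α : Type*} (p : Fin (n + 1)) (s t : α) {y y' : Fin n → α}
    (j : Fin n) (h : ∀ l, l ≠ j → y l = y' l) (m : Fin (n + 2))
    (hm : m ≠ p.castSucc.succAbove (p.succAbove j)) :
    (p.castSucc.insertNth s (p.insertNth t y : Fin (n + 1) → α) : Fin (n + 2) → α) m =
      (p.castSucc.insertNth s (p.insertNth t y' : Fin (n + 1) → α) : Fin (n + 2) → α) m := by
  refine Fin.succAboveCases p.castSucc (fun _ => ?_) (fun m hm => ?_) m hm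
  · simp
  · simp only [Fin.insertNth_apply_succAbove]
    refine Fin.succAboveCases p (fun _ => ?_) (fun m hm => ?_) m hm
    · simp
    · simp only [Fin.insertNth_apply_succAbove]
      exact h m fun h => hm (by rw [h])

variable [TopologicalSpace G]

theorem continuous_omitVar (i : Fin (k + 1)) {F : (Fin (k + 1) → G) → ℝ} (hF : Continuous F) :
    Continuous (omitVar i F) := by
  unfold omitVar
  fun_prop

variable [IsTopologicalGroup G]

theorem continuous_N (i : Fin (k + 1)) {f : (Fin k → G) → ℝ} (hf : Continuous f) :
    Continuous (N i f) := hf.comp (continuous_shift_side_base i)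

variable [CompactSpace G]

/-- Cauchy–Schwarz runs over the `n` variables other than the adjacent pair, with the pair `(s, t)`
as parameter; mixing is then applied for each fixed `z`. -/
theorem IsQuasirandom.pow_avg_side_mul_prod_le {D : ℝ} (hD : 0 < D) (hG : IsQuasirandom G D)
    (p : Fin (n + 1)) {h : G → ℝ} (hh : Continuous h) (hh1 : ∀ g, |h g| ≤ 1)
    {f : Fin (n + 2) → (Fin (n + 1) → G) → ℝ} (hf : ∀ i, Continuous (f i))
    (hf1 : ∀ i a, |f i a| ≤ 1) :
    (avg fun x => h (side x) * ∏ i, N i (f i) x) ^ 2 ^ n ≤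
      avg fun z : Fin n × Bool → G =>
        |avg fun s => ∏ ε : Fin n → Bool,
            omitVar p.succ (N p.succ (f p.succ)) (p.insertNth s fun j => z (j, ε j))| *
          |avg fun t => ∏ ε : Fin n → Bool,
            omitVar p.castSucc (N p.castSucc (f p.castSucc)) (p.insertNth t fun j => z (j, ε j))| +
          D ^ (-((1 : ℝ) / 2)) := by
  have hN (i) : Continuous (N i (f i)) := continuous_N i (hf i)
  have hW (i) : Continuous (omitVar i (N i (f i))) := continuous_omitVar i (hN i)
  have hW1 (i y) : |omitVar i (N i (f i)) y| ≤ 1 := hf1 _ _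
  have hside := continuous_side (G := G) (k := n + 1)
  let X (q : (Fin n → G) × (G × G)) : Fin (n + 2) → G :=
    p.castSucc.insertNth q.2.1 (p.insertNth q.2.2 q.1 : Fin (n + 1) → G)
  have hX : Continuous X := by unfold X; fun_prop
  let Ψ (q : (Fin n → G) × (G × G)) : ℝ := h (side (X q)) *
    (omitVar p.succ (N p.succ (f p.succ)) (p.insertNth q.2.1 q.1) *
      omitVar p.castSucc (N p.castSucc (f p.castSucc)) (p.insertNth q.2.2 q.1))
  have hΨ : Continuous Ψ := by unfold Ψ; fun_prop
  let F (j : Fin n) (q : (Fin n → G) × (G × G)) : ℝ :=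
    N (p.castSucc.succAbove (p.succAbove j)) (f (p.castSucc.succAbove (p.succAbove j))) (X q)
  have hF (j) : Continuous (F j) := by unfold F; fun_prop
  have h1 : (avg fun x => h (side x) * ∏ i, N i (f i) x) =
      avg fun q => avg fun y => Ψ (y, q) * ∏ j, F j (y, q) := by
    have hK (s t : G) (y : Fin n → G) : h (side (X (y, (s, t)))) * ∏ i, N i (f i) (X (y, (s, t))) =
        Ψ (y, (s, t)) * ∏ j, F j (y, (s, t)) := by
      have h3 : N p.castSucc (f p.castSucc) (X (y, (s, t))) =
          omitVar p.castSucc (N p.castSucc (f p.castSucc)) (p.insertNth t y) := N_insertNth _ _ _ _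
      have h4 : N p.succ (f p.succ) (X (y, (s, t))) =
          omitVar p.succ (N p.succ (f p.succ)) (p.insertNth s y) := by
        simp only [X]
        rw [insertNth_insertNth_comm, N_insertNth]
      rw [Fin.prod_univ_succAbove _ p.castSucc, Fin.prod_univ_succAbove _ p,
        Fin.succAbove_castSucc_self, h3, h4]
      simp only [Ψ, F]
      ring
    rw [avg_comm (by fun_prop), avg_insertNth p.castSucc (by fun_prop),
      avg_insertNth p (continuous_avg (by fun_prop))]
    congr 1
    funext y
    rw [avg_prod (by fun_prop), avg_comm (by fun_prop)]
    congr 1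
    funext s
    congr 1
    funext t
    exact hK s t y
  have h2 := pow_avg_mul_prod_le n hΨ hF (fun j q => hf1 _ _) fun j q y y' hy =>
    N_congr _ _ (insertNth_insertNth_congr p _ _ j hy)
  rw [h1]
  refine h2.trans ?_
  rw [avg_comm (by fun_prop)]
  refine avg_mono (continuous_avg (by fun_prop)) ?_ fun z => ?_
  · refine ((Continuous.abs (continuous_avg ?_)).mul
      (Continuous.abs (continuous_avg ?_))).add continuous_const <;> fun_prop
  · choose P Q hPQ using fun ε : Fin n → Bool =>
      exists_side_insertNth_insertNth p fun j => z (j, ε j)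
    -- For fixed `z` the product of the weights over all `ε` is one function of $g = st$, still
    -- bounded by 1.
    refine le_trans (le_of_eq ?_) ((le_abs_self _).trans (hG.abs_avg_mul_le hD
      (A := fun s => ∏ ε : Fin n → Bool,
            omitVar p.succ (N p.succ (f p.succ)) (p.insertNth s fun j => z (j, ε j)))
      (B := fun t => ∏ ε : Fin n → Bool,
            omitVar p.castSucc (N p.castSucc (f p.castSucc)) (p.insertNth t fun j => z (j, ε j)))
      (u := fun g => ∏ ε : Fin n → Bool, h (P ε * g * Q ε)) (by fun_prop) (by fun_prop)
      (by fun_prop) (fun s => abs_prod_le_one _ fun ε => hW1 _ _)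
      (fun s => abs_prod_le_one _ fun ε => hW1 _ _) fun g => abs_prod_le_one _ fun ε => hh1 _))
    rw [avg_prod (by fun_prop)]
    simp only [Ψ, X, hPQ, Finset.prod_mul_distrib]
    congr 1
    funext s
    congr 1
    funext t
    ring

theorem IsQuasirandom.avg_side_mul_prod_le {D : ℝ} (hD : 0 < D) (hG : IsQuasirandom G D)
    (i : Fin (n + 2)) {h : G → ℝ} (hh : Continuous h) (hh1 : ∀ g, |h g| ≤ 1)
    {f : Fin (n + 2) → (Fin (n + 1) → G) → ℝ} (hf : ∀ i, Continuous (f i))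
    (hf1 : ∀ i a, |f i a| ≤ 1) :
    (avg fun x => h (side x) * ∏ i, N i (f i) x) ≤
      boxNorm (omitVar i (N i (f i))) + D ^ (-((1 : ℝ) / 2 ^ (n + 1))) := by
  have hW (i) : Continuous (omitVar i (N i (f i))) := continuous_omitVar i (continuous_N i (hf i))
  let A (i : Fin (n + 2)) (p : Fin (n + 1)) (z : Fin n × Bool → G) : ℝ :=
    avg fun s => ∏ ε : Fin n → Bool, omitVar i (N i (f i)) (p.insertNth s fun j => z (j, ε j))
  have hA (i p) : Continuous (A i p) := continuous_avg (by fun_prop)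
  have hA1 (i p z) : |A i p z| ≤ 1 :=
    abs_avg_le_of_abs_le (by fun_prop) fun s => abs_prod_le_one _ fun ε => hf1 _ _
  -- For `i = 0` the pair is $(x_0, x_1)$ and the mean from index 0 is kept; for `i = p.succ` the
  -- pair is $(x_p, x_{p+1})$ and the mean from the second index is kept.
  obtain ⟨p, hp⟩ : ∃ p : Fin (n + 1), (avg fun x => h (side x) * ∏ i, N i (f i) x) ^ 2 ^ n ≤
      avg fun z => |A i p z| + D ^ (-((1 : ℝ) / 2)) := by
    have h1 (p) := hG.pow_avg_side_mul_prod_le hD p hh hh1 hf hf1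
    have h2 (p : Fin (n + 1)) : Continuous fun z =>
      |A p.succ p z| * |A p.castSucc p z| + D ^ (-((1 : ℝ) / 2)) := by fun_prop
    refine Fin.cases ⟨0, (h1 0).trans (avg_mono (h2 0) (by fun_prop) fun z => ?_)⟩
      (fun p => ⟨p, (h1 p).trans (avg_mono (h2 p) (by fun_prop) fun z => ?_)⟩) i
    · gcongr
      exact mul_le_of_le_one_left (abs_nonneg _) (hA1 _ _ _)
    · gcongr
      exact mul_le_of_le_one_right (abs_nonneg _) (hA1 _ _ _)
  rw [avg_add (hA i p).abs continuous_const, avg_const] at hp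
  -- Squaring the mean over `s` doubles the last single variable, which completes the box integral.
  have h3 : (avg fun z => |A i p z|) ^ 2 ≤
      avg fun x : Fin (n + 1) × Bool → G => ∏ ε : Fin (n + 1) → Bool,
        omitVar i (N i (f i)) fun j => x (j, ε j) := by
    refine (sq_avg_le (hA i p).abs).trans (le_of_eq ?_)
    rw [avg_insertPair p (by fun_prop)]
    simp only [prod_insertPair p (omitVar i (N i (f i)))]
    rw [avg_prod (by fun_prop)]
    congr 1
    funext z
    rw [sq_abs, sq_avg_eq (by fun_prop)]
    simp only [Finset.prod_mul_distrib]
  set I := avg fun x : Fin (n + 1) × Bool → G => ∏ ε : Fin (n + 1) → Bool,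
        omitVar i (N i (f i)) fun j => x (j, ε j) with hI
  have hI0 : 0 ≤ I := (sq_nonneg _).trans h3
  have hbox : boxNorm (omitVar i (N i (f i))) = I ^ ((1 : ℝ) / 2 ^ (n + 1)) := rfl
  have hroot {c : ℝ} (hc : 0 ≤ c) (r : ℝ) :
      (c ^ (r * ((1 : ℝ) / 2 ^ (n + 1)))) ^ 2 ^ n = c ^ (r * ((1 : ℝ) / 2)) := by
    rw [← Real.rpow_natCast, ← Real.rpow_mul hc]
    congr 1
    push_cast
    rw [pow_succ]
    field_simp
  have hroot1 := hroot hI0 1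
  have hroot2 := hroot hD.le (-1)
  simp only [one_mul, neg_one_mul] at hroot1 hroot2
  have h4 : (avg fun z => |A i p z|) ≤ I ^ ((1 : ℝ) / 2) := by
    rw [← Real.sqrt_eq_rpow]
    exact Real.le_sqrt_of_sq_le h3
  rw [hbox]
  -- The root is distributed over the sum by $a^m + b^m \le (a + b)^m$ for $a, b \ge 0$, at no cost
  -- in the constant.
  refine le_of_pow_le_pow_left₀ (n := 2 ^ n) (by positivity) (by positivity) ?_
  refine (hp.trans (add_le_add_left h4 _)).trans ?_
  rw [← hroot1, ← hroot2]
  exact pow_add_pow_le (by positivity) (by positivity) (by positivity)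

theorem IsQuasirandom.avg_abs_multicorrelation_le {D : ℝ} (hD : 0 < D) (hG : IsQuasirandom G D)
    (i : Fin (n + 2)) {f : Fin (n + 2) → (Fin (n + 1) → G) → ℝ} (hf : ∀ i, Continuous (f i))
    (hf1 : ∀ i a, |f i a| ≤ 1) :
    (avg fun g => |multicorrelation f g|) ≤
      boxNorm (omitVar i (N i (f i))) + D ^ (-((1 : ℝ) / 2 ^ (n + 1))) := by
  have hs := continuous_shift (G := G) (k := n + 1)
  have hc : Continuous (multicorrelation f) := continuous_avg (by fun_prop)
  refine le_of_forall_pos_le_add fun δ hδ => ?_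
  have hpos (g : G) : 0 < |multicorrelation f g| + δ := by positivity
  -- A continuous substitute for the sign of $c_g$, satisfying $h(g) c_g \ge |c_g| - \delta$.
  let h (g : G) : ℝ := multicorrelation f g / (|multicorrelation f g| + δ)
  have hh : Continuous h := hc.div (by fun_prop) fun g => (hpos g).ne'
  have hh1 (g : G) : |h g| ≤ 1 := by
    rw [abs_div, abs_of_pos (hpos g), div_le_one (hpos g)]
    linarith
  have h1 := hG.avg_side_mul_prod_le hD i hh hh1 hf hf1
  have h2 : (avg fun x => h (side x) * ∏ i, N i (f i) x) =
      avg fun g => h g * multicorrelation f g := by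
    refine (avg_side_base (Φ := fun q => h q.1 * ∏ i, f i (shift i q.1 q.2)) (by fun_prop)).trans ?_
    simp only [avg_const_mul]
    rfl
  rw [h2] at h1
  have h3 : (avg fun g => |multicorrelation f g|) ≤
      avg fun g => h g * multicorrelation f g + δ := by
    refine avg_mono hc.abs (by fun_prop) fun g => ?_
    simp only [h]
    rw [div_mul_eq_mul_div, ← sub_le_iff_le_add, le_div_iff₀ (hpos g)]
    nlinarith [abs_mul_abs_self (multicorrelation f g)]
  rw [avg_add (by fun_prop) continuous_const, avg_const] at h3
  linarith

end ContinuousCase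

/-! ### Approximation in $L^1$ and stability of integrals of products -/

section Approximation

theorem abs_prod_sub_prod_le {ι : Type*} (s : Finset ι) {F H : ι → ℝ} (hF : ∀ j, |F j| ≤ 1)
    (hH : ∀ j, |H j| ≤ 1) : |∏ j ∈ s, F j - ∏ j ∈ s, H j| ≤ ∑ j ∈ s, |F j - H j| := by
  classical
  induction s using Finset.induction_on with
  | empty => simp
  | insert a s ha ih =>
    rw [Finset.prod_insert ha, Finset.prod_insert ha, Finset.sum_insert ha]
    calc |F a * ∏ j ∈ s, F j - H a * ∏ j ∈ s, H j|
        = |(F a - H a) * ∏ j ∈ s, F j + H a * (∏ j ∈ s, F j - ∏ j ∈ s, H j)| := by ring_nf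
      _ ≤ |F a - H a| * |∏ j ∈ s, F j| + |H a| * |∏ j ∈ s, F j - ∏ j ∈ s, H j| := by
          rw [← abs_mul, ← abs_mul]
          exact abs_add_le _ _
      _ ≤ |F a - H a| * 1 + 1 * |∏ j ∈ s, F j - ∏ j ∈ s, H j| := by
          gcongr
          · exact abs_prod_le_one s hF
          · exact hH a
      _ ≤ |F a - H a| + ∑ j ∈ s, |F j - H j| := by linarith

theorem abs_integral_prod_sub_le {ι X Y : Type*} [Fintype ι] [MeasurableSpace X]
    [MeasurableSpace Y] {μ : Measure X} {ν : Measure Y} [IsProbabilityMeasure μ]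
    [IsProbabilityMeasure ν] {φ : ι → X → Y} (hφ : ∀ j, MeasurePreserving (φ j) μ ν)
    {F H : ι → Y → ℝ} (hF : ∀ j, AEMeasurable (F j) ν) (hH : ∀ j, AEMeasurable (H j) ν)
    (hF1 : ∀ j y, |F j y| ≤ 1) (hH1 : ∀ j y, |H j y| ≤ 1) :
    |∫ x, ∏ j, F j (φ j x) ∂μ - ∫ x, ∏ j, H j (φ j x) ∂μ| ≤ ∑ j, ∫ y, |F j y - H j y| ∂ν := by
  have hprod {F : ι → Y → ℝ} (hF : ∀ j, AEMeasurable (F j) ν) (hF1 : ∀ j y, |F j y| ≤ 1) :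
      Integrable (fun x => ∏ j, F j (φ j x)) μ := by
    refine Integrable.of_bound (Finset.aemeasurable_fun_prod _ fun j _ =>
      (hF j).comp_quasiMeasurePreserving (hφ j).quasiMeasurePreserving).aestronglyMeasurable 1
      (.of_forall fun x => ?_)
    exact abs_prod_le_one _ fun j => hF1 j _
  have hd (j) : Integrable (fun y => |F j y - H j y|) ν := by
    refine Integrable.of_bound ((hF j).sub (hH j)).abs.aestronglyMeasurable 2
      (.of_forall fun y => ?_)
    rw [Real.norm_eq_abs, abs_abs]
    exact (abs_sub _ _).trans (by linarith [hF1 j y, hH1 j y])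
  have hd' (j) : Integrable (fun x => |F j (φ j x) - H j (φ j x)|) μ :=
    (hφ j).integrable_comp_of_integrable (hd j)
  rw [← integral_sub (hprod hF hF1) (hprod hH hH1)]
  calc _ ≤ ∫ x, |∏ j, F j (φ j x) - ∏ j, H j (φ j x)| ∂μ := abs_integral_le_integral_abs
    _ ≤ ∫ x, ∑ j, |F j (φ j x) - H j (φ j x)| ∂μ :=
        integral_mono ((hprod hF hF1).sub (hprod hH hH1)).abs
          (integrable_finsetSum _ fun j _ => hd' j)
          fun x => abs_prod_sub_prod_le _ (fun j => hF1 j _) fun j => hH1 j _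
    _ = ∑ j, ∫ y, |F j y - H j y| ∂ν := by
        rw [integral_finsetSum _ fun j _ => hd' j]
        refine Finset.sum_congr rfl fun j _ => ?_
        rw [← (hφ j).map_eq, integral_map (hφ j).measurable.aemeasurable
          ((hφ j).map_eq ▸ (hd j).aestronglyMeasurable)]

theorem exists_continuous_integral_sub_le {X : Type*} [TopologicalSpace X] [CompactSpace X]
    [R1Space X] [MeasurableSpace X] [BorelSpace X] {μ : Measure X} [μ.Regular] [IsFiniteMeasure μ]
    {f : X → ℝ} (hf : AEMeasurable f μ) (hf1 : ∀ x, |f x| ≤ 1) {δ : ℝ} (hδ : 0 < δ) :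
    ∃ g : X → ℝ, Continuous g ∧ (∀ x, |g x| ≤ 1) ∧ ∫ x, |f x - g x| ∂μ ≤ δ := by
  have hfi : Integrable f μ := Integrable.of_bound hf.aestronglyMeasurable 1 (.of_forall hf1)
  obtain ⟨g, -, hg, hgc, hgi⟩ := hfi.exists_hasCompactSupport_integral_sub_le hδ
  -- Truncation to $[-1, 1]$ is 1-Lipschitz and fixes `f`, so it does not increase the error.
  refine ⟨fun x => max (-1) (min 1 (g x)), by fun_prop, fun x => ?_, le_trans ?_ hg⟩
  · rw [abs_le]
    exact ⟨le_max_left _ _, max_le (by norm_num) (min_le_left _ _)⟩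
  · refine integral_mono_of_nonneg (.of_forall fun x => abs_nonneg _) (hfi.sub hgi).norm
      (.of_forall fun x => ?_)
    have hx : f x = max (-1) (min 1 (f x)) := by
      rw [min_eq_right (abs_le.1 (hf1 x)).2, max_eq_right (abs_le.1 (hf1 x)).1]
    change |f x - max (-1) (min 1 (g x))| ≤ ‖f x - g x‖
    conv_lhs => rw [hx]
    refine (abs_max_sub_max_le_max _ _ _ _).trans ?_
    rw [sub_self, abs_zero]
    refine max_le (norm_nonneg _) ((abs_min_sub_min_le_max _ _ _ _).trans ?_)
    rw [sub_self, abs_zero]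
    exact max_le (norm_nonneg _) le_rfl

/-- The image measure and Haar measure are both regular, so agreement on continuous functions
suffices. -/
theorem measurePreserving_of_avg_comp {X Y : Type*} [Group X] [TopologicalSpace X]
    [IsTopologicalGroup X] [CompactSpace X] [Group Y] [TopologicalSpace Y] [IsTopologicalGroup Y]
    [CompactSpace Y] [T2Space Y] {φ : X → Y} (hφ : Continuous φ)
    (h : ∀ F : Y → ℝ, Continuous F → avg (fun x => F (φ x)) = avg F) :
    @MeasurePreserving X Y (borel X) (borel Y) φ (haarProb X) (haarProb Y) := by
  let : MeasurableSpace X := borel X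
  have : BorelSpace X := ⟨rfl⟩
  let : MeasurableSpace Y := borel Y
  have : BorelSpace Y := ⟨rfl⟩
  have := isProbabilityMeasure_haarMeasure_top (X := X)
  have := isProbabilityMeasure_haarMeasure_top (X := Y)
  let μ := Measure.haarMeasure (⊤ : TopologicalSpace.PositiveCompacts X)
  refine ⟨hφ.measurable, ?_⟩
  have := Measure.InnerRegularCompactLTTop.map_of_continuous (μ := μ) hφ
  have := Measure.isFiniteMeasure_map μ φ
  refine Measure.ext_of_integral_eq_on_compactlySupported (μ := μ.map φ)
    (ν := Measure.haarMeasure (⊤ : TopologicalSpace.PositiveCompacts Y)) fun F => ?_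
  have hF : Continuous fun y => F y := F.continuous
  rw [integral_map hφ.aemeasurable hF.measurable.aestronglyMeasurable]
  exact h _ hF

end Approximation

/-! ### Passage from continuous to measurable functions -/

section Stability

variable {G : Type*} [Group G] [TopologicalSpace G] [IsTopologicalGroup G] [CompactSpace G]
  [T2Space G] {k : ℕ}

theorem measurePreserving_shift (i : Fin (k + 1)) (g : G) :
    @MeasurePreserving (Fin k → G) (Fin k → G) (borel _) (borel _) (shift i g)
      (haarProb (Fin k → G)) (haarProb (Fin k → G)) := by
  refine measurePreserving_of_avg_comp
    ((continuous_shift i).comp (continuous_const.prodMk continuous_id)) fun F _ => ?_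
  simp only [shift_eq_mul, avg_mul_left]

/-- Choosing one copy of each variable is a surjective homomorphism, and `avg_omitVar_N` handles the
rest of the composition. -/
theorem measurePreserving_omitVar (i : Fin (k + 1)) (ε : Fin k → Bool) :
    @MeasurePreserving (Fin k × Bool → G) (Fin k → G) (borel _) (borel _)
      (fun x => (fun z => shift i (side z) (base z))
        (Fin.insertNth (α := fun _ => G) i 1 fun j => x (j, ε j)))
      (haarProb (Fin k × Bool → G)) (haarProb (Fin k → G)) := by
  have hc := continuous_shift_side_base (G := G) i
  refine measurePreserving_of_avg_comp (hc.comp (by fun_prop)) fun F hF => ?_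
  rw [← avg_omitVar_N i hF]
  let π : (Fin k × Bool → G) →* (Fin k → G) :=
    { toFun := fun x j => x (j, ε j)
      map_one' := rfl
      map_mul' := fun _ _ => rfl }
  exact avg_comp_monoidHom (φ := π)
    (by change Continuous fun (x : Fin k × Bool → G) j => x (j, ε j); fun_prop)
    (fun y => ⟨fun q => y q.1, rfl⟩) (continuous_omitVar i (continuous_N i hF))

theorem abs_multicorrelation_sub_le {f f' : Fin (k + 1) → (Fin k → G) → ℝ}
    (hf : ∀ i, AEMeasurable (f i) (haarProb (Fin k → G)))
    (hf' : ∀ i, AEMeasurable (f' i) (haarProb (Fin k → G))) (hf1 : ∀ i a, |f i a| ≤ 1)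
    (hf1' : ∀ i a, |f' i a| ≤ 1) (g : G) :
    |multicorrelation f g - multicorrelation f' g| ≤
      ∑ i, avg fun a => |f i a - f' i a| := by
  let : MeasurableSpace (Fin k → G) := borel _
  have := isProbabilityMeasure_haarProb (X := Fin k → G)
  exact abs_integral_prod_sub_le (fun i => measurePreserving_shift i g) hf hf' hf1 hf1'

theorem abs_boxIntegral_sub_le (i : Fin (k + 1)) {f f' : (Fin k → G) → ℝ}
    (hf : AEMeasurable f (haarProb (Fin k → G)))
    (hf' : AEMeasurable f' (haarProb (Fin k → G))) (hf1 : ∀ a, |f a| ≤ 1)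
    (hf1' : ∀ a, |f' a| ≤ 1) :
    |(avg fun x : Fin k × Bool → G =>
          ∏ ε : Fin k → Bool, omitVar i (N i f) fun j => x (j, ε j)) -
        avg fun x : Fin k × Bool → G =>
          ∏ ε : Fin k → Bool, omitVar i (N i f') fun j => x (j, ε j)| ≤
      2 ^ k * avg fun a => |f a - f' a| := by
  let : MeasurableSpace (Fin k → G) := borel _
  let : MeasurableSpace (Fin k × Bool → G) := borel _
  have := isProbabilityMeasure_haarProb (X := Fin k → G)
  have := isProbabilityMeasure_haarProb (X := Fin k × Bool → G)
  refine (abs_integral_prod_sub_le (F := fun _ => f) (H := fun _ => f')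
    (fun ε => measurePreserving_omitVar i ε) (fun _ => hf) (fun _ => hf') (fun _ => hf1)
    fun _ => hf1').trans (le_of_eq ?_)
  simp [avg]

theorem avg_abs_multicorrelation_le_add {f f' : Fin (k + 1) → (Fin k → G) → ℝ}
    (hf : ∀ i, AEMeasurable (f i) (haarProb (Fin k → G))) (hf' : ∀ i, Continuous (f' i))
    (hf1 : ∀ i a, |f i a| ≤ 1) (hf1' : ∀ i a, |f' i a| ≤ 1) :
    (avg fun g => |multicorrelation f g|) ≤
      (avg fun g => |multicorrelation f' g|) + ∑ i, avg fun a => |f i a - f' i a| := by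
  let : MeasurableSpace G := borel G
  let : MeasurableSpace (Fin k → G) := borel _
  have hs := continuous_shift (G := G) (k := k)
  have hc : Continuous (multicorrelation f') := continuous_avg (by fun_prop)
  rw [← avg_const (X := G) (∑ i, avg fun a => |f i a - f' i a|),
    ← avg_add hc.abs continuous_const]
  -- This comparison needs integrability of the larger side only, so measurability of $g \mapsto
  -- |c_g|$ never has to be shown.
  refine integral_mono_of_nonneg (.of_forall fun g => abs_nonneg _)
    (integrable_haarProb (by fun_prop)) (.of_forall fun g => ?_)
  have h := abs_multicorrelation_sub_le hf
    (fun i => (integrable_haarProb (hf' i)).aestronglyMeasurable.aemeasurable) hf1 hf1' g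
  have h' := abs_sub_abs_le_abs_sub (multicorrelation f g) (multicorrelation f' g)
  simp only
  linarith

theorem exists_continuous_avg_sub_le {X : Type*} [Group X] [TopologicalSpace X]
    [IsTopologicalGroup X] [CompactSpace X] {f : X → ℝ} (hf : AEMeasurable f (haarProb X))
    (hf1 : ∀ x, |f x| ≤ 1) {δ : ℝ} (hδ : 0 < δ) :
    ∃ g : X → ℝ, Continuous g ∧ (∀ x, |g x| ≤ 1) ∧ (avg fun x => |f x - g x|) ≤ δ := by
  let : MeasurableSpace X := borel X
  have : BorelSpace X := ⟨rfl⟩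
  have := isProbabilityMeasure_haarMeasure_top (X := X)
  exact exists_continuous_integral_sub_le
    (μ := Measure.haarMeasure (⊤ : TopologicalSpace.PositiveCompacts X)) hf hf1 hδ

theorem IsQuasirandom.avg_abs_multicorrelation_le_of_aemeasurable {n : ℕ} {D : ℝ} (hD : 0 < D)
    (hG : IsQuasirandom G D) (i : Fin (n + 2)) {f : Fin (n + 2) → (Fin (n + 1) → G) → ℝ}
    (hf : ∀ i, AEMeasurable (f i) (haarProb (Fin (n + 1) → G))) (hf1 : ∀ i a, |f i a| ≤ 1) :
    (avg fun g => |multicorrelation f g|) ≤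
      boxNorm (omitVar i (N i (f i))) + D ^ (-((1 : ℝ) / 2 ^ (n + 1))) := by
  choose f' hf' hf1' hff' using fun (m : ℕ) (i : Fin (n + 2)) =>
    exists_continuous_avg_sub_le (hf i) (hf1 i) (Nat.one_div_pos_of_nat (α := ℝ) (n := m))
  have hlim : Filter.Tendsto (fun m : ℕ => 1 / ((m : ℝ) + 1)) Filter.atTop (nhds 0) :=
    tendsto_one_div_add_atTop_nhds_zero_nat
  have hbox : Filter.Tendsto (fun m => boxNorm (omitVar i (N i (f' m i)))) Filter.atTop
      (nhds (boxNorm (omitVar i (N i (f i))))) := by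
    refine Filter.Tendsto.rpow_const ?_ (Or.inr (by positivity))
    rw [tendsto_iff_dist_tendsto_zero]
    refine squeeze_zero (fun _ => dist_nonneg) (fun m => ?_)
      (by simpa only [mul_zero] using hlim.const_mul (2 ^ (n + 1)))
    rw [dist_comm]
    refine (abs_boxIntegral_sub_le i (hf i) ?_ (hf1 i) (hf1' m i)).trans
      (by gcongr; exact hff' m i)
    let : MeasurableSpace (Fin (n + 1) → G) := borel _
    exact (integrable_haarProb (hf' m i)).aestronglyMeasurable.aemeasurable
  have hsum : Filter.Tendsto (fun m => (boxNorm (omitVar i (N i (f' m i))) +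
      D ^ (-((1 : ℝ) / 2 ^ (n + 1)))) + ∑ _ : Fin (n + 2), 1 / ((m : ℝ) + 1)) Filter.atTop
      (nhds ((boxNorm (omitVar i (N i (f i))) + D ^ (-((1 : ℝ) / 2 ^ (n + 1)))) +
        ∑ _ : Fin (n + 2), 0)) :=
    (hbox.add_const _).add (tendsto_finsetSum _ fun _ _ => hlim)
  rw [Finset.sum_const_zero, add_zero] at hsum
  refine ge_of_tendsto' hsum fun m => ?_
  refine (avg_abs_multicorrelation_le_add hf (hf' m) hf1 (hf1' m)).trans (add_le_add ?_ ?_)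
  · exact hG.avg_abs_multicorrelation_le hD i (hf' m) (hf1' m)
  · exact Finset.sum_le_sum fun i _ => hff' m i

end Stability

end BoxCorners

/-! ### The proposition -/

theorem mainTheorem3 (k : ℕ) (hk : 1 ≤ k) :
    ∃ C : ℝ, ∀ (G : Type*) [Group G] [TopologicalSpace G] [IsTopologicalGroup G]
      [CompactSpace G] [T2Space G] (D : ℝ), 0 < D → BoxCorners.IsQuasirandom G D →
      ∀ f : Fin (k + 1) → (Fin k → G) → ℝ,
        (∀ i, AEMeasurable (f i) (BoxCorners.haarProb (Fin k → G))) →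
        (∀ i a, f i a ∈ Set.Icc (-1 : ℝ) 1) →
        ∫ g, |BoxCorners.multicorrelation f g| ∂(BoxCorners.haarProb G) ≤
          (⨅ i : Fin (k + 1), BoxCorners.boxNorm (BoxCorners.omitVar i (BoxCorners.N i (f i)))) +
            C * D ^ (-((1 : ℝ) / 2 ^ k)) := by
  obtain ⟨n, rfl⟩ : ∃ n, k = n + 1 := ⟨k - 1, by omega⟩
  -- The bound holds with constant 1 for each `i` separately, hence for the infimum.
  refine ⟨1, fun G _ _ _ _ _ D hD hG f hf hf1 => ?_⟩
  rw [one_mul, ← sub_le_iff_le_add]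
  refine le_ciInf fun i => ?_
  rw [sub_le_iff_le_add]
  exact hG.avg_abs_multicorrelation_le_of_aemeasurable hD i hf fun i a => abs_le.2 (hf1 i a)
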